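/- **Theorem (In-context learning with imbalanced features).** *Setting.* Let $v_1,\dots,v_K\in\mathbb R^d$ be orthonormal features and $p_1,\dots,p_K>0$ with $\sum_k p_k=1$. A prompt consists of tokens $x_1,\dots,x_N$ and a query $x_{\rm query}$, drawn independently with $P(x=v_k)=p_k$, and of the labels $y_i=\langle w,x_i\rangle$, where the task weight $w\in\mathbb R^d$ is independent of the tokens and has a distribution with mean zero and identity covariance. For a parameter $Q\in\mathbb R^{d\times d}$ the one-layer softmax transformer predicts $$\hat y_{\rm query}=\sum_{i=1}^N \mathrm{attn}_i\,y_i,\qquad \mathrm{attn}_i=\frac{e^{x_i^\top Qx_{\rm query}}}{\sum_{j=1}^N e^{x_j^\top Qx_{\rm query}}},\qquad \mathrm{Attn}_k=\sum_{i:\,x_i=v_k}\mathrm{attn}_i .$$ Let $L(Q)=\frac12\mathbb E[(\hat y_{\rm query}-\langle w,x_{\rm query}\rangle)^2]$, let $\mathcal L_k(Q)=\frac12\mathbb E[(\hat y_{\rm query}-\langle w,x_{\rm query}\rangle)^2\mid x_{\rm query}=v_k]$ and $\mathcal L_k^*=\inf_Q\mathcal L_k(Q)$. Gradient descent with learning rate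 $\eta>0$ is $Q^{(0)}=0$, $Q^{(t+1)}=Q^{(t)}-\eta\nabla L(Q^{(t)})$. *Statement.* Let $a,b,\eta_{\max}>0$. There are constants $c,C>0$, depending only on $a,b,\eta_{\max}$, such that for every $m\in\mathbb N$ there is $K_0$ for which the following holds whenever $K\ge K_0$, $N\ge K^3$, $p_1\ge a$, $a/K\le p_k\le b/K$ for $2\le k\le K$ (that is, $p_1=\Theta(1)$ and $p_k=\Theta(1/K)$), $0<\varepsilon<1$, $\log(1/\varepsilon)\le(\log K)^m$ and $0<\eta\le\eta_{\max}$. 1. *Dominant feature.* $e^{-CN}\le\mathcal L_1^*\le e^{-cN}$, and there is a number of iterations $T_1\le C\,\dfrac{\log(\varepsilon^{-1/2})}{\eta\varepsilon}$ with $\mathcal L_1(Q^{(T_1)})\le\mathcal L_1^*+\varepsilon$. 2. *Under-represented features.* For each $2\le k\le K$, $e^{-CN/K}\le\mathcal L_k^*\le e^{-cN/K}$, and there is a number of iterations $T_k\le C\left(\dfrac{K^2\log K}{\eta}+\dfrac{K\log(K\varepsilon^{-1/2})}{\varepsilon\eta}\right)$ with $\mathcal L_k(Q^{(T_k)})\le\mathcal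 L_k^*+\varepsilon$. 3. *Attention concentrates.* For each $k\in\{1,\dots,K\}$ and the same $T_k$: if the query is $v_k$, then with probability at least $1-e^{-cN/K^2}$ over the input tokens $x_1,\dots,x_N$ the attention score at $Q^{(T_k)}$ satisfies $(1-\mathrm{Attn}_k)^2\le C\varepsilon$. In particular, if $N$ is polynomial in $K$, then $\mathcal L_k^*=\Theta(e^{-\mathrm{poly}(K)})$ for all $k$, and the probability in part 3 is $1-e^{-\Omega(\mathrm{poly}(K))}$. -/

import Mathlib

open scoped Matrix BigOperators

noncomputable section

namespace ICL

/-! ## One-layer softmax transformer -/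

/-- `E^x`: the inputs `x_1, ..., x_N` followed by the query, as columns. -/
def embX {d N : ℕ} (x : Fin N → Fin d → ℝ) (xq : Fin d → ℝ) :
    Matrix (Fin d) (Fin (N + 1)) ℝ :=
  Matrix.of fun a j => (Fin.snoc x xq : Fin (N + 1) → Fin d → ℝ) j a

/-- `E^y`: the labels `y_1, ..., y_N` followed by `0`, as a row. -/
def embY {N : ℕ} (y : Fin N → ℝ) : Matrix (Fin 1) (Fin (N + 1)) ℝ :=
  Matrix.of fun _ j => (Fin.snoc y 0 : Fin (N + 1) → ℝ) j

/-- The mask `M`, which removes the last column. -/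
def mask {m : Type*} {N : ℕ} (A : Matrix m (Fin (N + 1)) ℝ) : Matrix m (Fin N) ℝ :=
  A.submatrix id Fin.castSucc

/-- The softmax function applied to every column. -/
def softmaxCols {N : ℕ} {m : Type*} (Z : Matrix (Fin N) m ℝ) : Matrix (Fin N) m ℝ :=
  Matrix.of fun i j => Real.exp (Z i j) / ∑ l, Real.exp (Z l j)

/-- `softmax (M(E^x)ᵀ Q E^x)`. -/
def attnMatrix {d N : ℕ} (Q : Matrix (Fin d) (Fin d) ℝ)
    (Ex : Matrix (Fin d) (Fin (N + 1)) ℝ) : Matrix (Fin N) (Fin (N + 1)) ℝ :=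
  softmaxCols ((mask Ex)ᵀ * Q * Ex)

/-- The transformer `F_SA(E; Q) = M(E^y) softmax (M(E^x)ᵀ Q E^x)`. -/
def FSA {d N : ℕ} (Q : Matrix (Fin d) (Fin d) ℝ)
    (Ex : Matrix (Fin d) (Fin (N + 1)) ℝ) (Ey : Matrix (Fin 1) (Fin (N + 1)) ℝ) :
    Matrix (Fin 1) (Fin (N + 1)) ℝ :=
  mask Ey * attnMatrix Q Ex

/-! ## Prompts

A prompt is given by the weight `w` of the linear task, the features `v (s i)` of the `N` input
tokens, where `s : Fin N → Fin K`, and the feature `v q` of the query token. -/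

/-- The prediction for the query: the last entry of the output on the prompt whose labels are
`y_i = ⟨w, x_i⟩`. -/
def prediction {d K N : ℕ} (v : Fin K → Fin d → ℝ) (Q : Matrix (Fin d) (Fin d) ℝ)
    (w : Fin d → ℝ) (s : Fin N → Fin K) (q : Fin K) : ℝ :=
  FSA Q (embX (fun i => v (s i)) (v q)) (embY fun i => w ⬝ᵥ v (s i)) 0 (Fin.last N)

/-- The attention score of the `i`-th input token (for the query column). -/
def tokenAttn {d K N : ℕ} (v : Fin K → Fin d → ℝ) (Q : Matrix (Fin d) (Fin d) ℝ)
    (s : Fin N → Fin K) (q : Fin K) (i : Fin N) : ℝ :=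
  attnMatrix Q (embX (fun i => v (s i)) (v q)) i (Fin.last N)

/-- The attention score of the `k`-th feature: the sum over all input tokens equal to `v k`. -/
def featureAttn {d K N : ℕ} (v : Fin K → Fin d → ℝ) (Q : Matrix (Fin d) (Fin d) ℝ)
    (s : Fin N → Fin K) (q k : Fin K) : ℝ :=
  ∑ i with s i = k, tokenAttn v Q s q i

/-- Orthonormality of the features. -/
def OrthonormalFeatures {d K : ℕ} (v : Fin K → Fin d → ℝ) : Prop :=
  ∀ m n, v m ⬝ᵥ v n = if m = n then 1 else 0

/-- A task distribution: zero mean and identity covariance. -/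
structure IsTaskDistribution {d : ℕ} (μ : MeasureTheory.Measure (Fin d → ℝ)) : Prop where
  isProbabilityMeasure : MeasureTheory.IsProbabilityMeasure μ
  memLp : ∀ i, MeasureTheory.MemLp (fun w : Fin d → ℝ => w i) 2 μ
  mean : ∀ i, ∫ w, w i ∂μ = 0
  covariance : ∀ i j, ∫ w, w i * w j ∂μ = if i = j then 1 else 0

/-- The probability of the sequence `s` of features, when they are drawn independently and
the `k`-th feature has probability `p k`. -/
def seqProb {K N : ℕ} (p : Fin K → ℝ) (s : Fin N → Fin K) : ℝ := ∏ i, p (s i)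

/-- The probability that the `N` input tokens belong to the event `S`. -/
def inputProb {K N : ℕ} (p : Fin K → ℝ) (S : Set (Fin N → Fin K)) : ℝ :=
  ∑ s, S.indicator (seqProb p) s

/-- The expectation over independent `w ∼ μ`, input tokens and query token. -/
def promptExp {d K N : ℕ} (μ : MeasureTheory.Measure (Fin d → ℝ)) (p : Fin K → ℝ)
    (f : (Fin d → ℝ) → (Fin N → Fin K) → Fin K → ℝ) : ℝ :=
  ∑ q, ∑ s, p q * seqProb p s * ∫ w, f w s q ∂μ

/-! ## Losses and gradient descent -/

/-- The squared prediction error on a prompt. -/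
def sqError {d K N : ℕ} (v : Fin K → Fin d → ℝ) (Q : Matrix (Fin d) (Fin d) ℝ)
    (w : Fin d → ℝ) (s : Fin N → Fin K) (q : Fin K) : ℝ :=
  (prediction v Q w s q - w ⬝ᵥ v q) ^ 2

/-- The population loss `L`. -/
def loss {d K : ℕ} (N : ℕ) (μ : MeasureTheory.Measure (Fin d → ℝ)) (p : Fin K → ℝ)
    (v : Fin K → Fin d → ℝ) (Q : Matrix (Fin d) (Fin d) ℝ) : ℝ :=
  1 / 2 * promptExp (N := N) μ p (sqError v Q)

/-- The prediction error `ℒ_k` conditioned on the event that the query is the `k`-th feature. -/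
def condLoss {d K : ℕ} (N : ℕ) (μ : MeasureTheory.Measure (Fin d → ℝ)) (p : Fin K → ℝ)
    (v : Fin K → Fin d → ℝ) (k : Fin K) (Q : Matrix (Fin d) (Fin d) ℝ) : ℝ :=
  1 / 2 * (promptExp (N := N) μ p (fun w s q => if q = k then sqError v Q w s q else 0) / p k)

/-- `ℒ_k^*`, the infimum of `ℒ_k` over all parameters. -/
def condLossStar {d K : ℕ} (N : ℕ) (μ : MeasureTheory.Measure (Fin d → ℝ)) (p : Fin K → ℝ)
    (v : Fin K → Fin d → ℝ) (k : Fin K) : ℝ :=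
  ⨅ Q : Matrix (Fin d) (Fin d) ℝ, condLoss N μ p v k Q

/-- The gradient of a function of a matrix: the matrix of its partial derivatives. -/
def matrixGrad {d : ℕ} (F : Matrix (Fin d) (Fin d) ℝ → ℝ) (Q : Matrix (Fin d) (Fin d) ℝ) :
    Matrix (Fin d) (Fin d) ℝ :=
  Matrix.of fun i j => deriv (fun h : ℝ => F (Q + h • Matrix.single i j (1 : ℝ))) 0

/-- Gradient descent on `L` with learning rate `η`, started at the zero matrix. -/
def gd {d K : ℕ} (N : ℕ) (μ : MeasureTheory.Measure (Fin d → ℝ)) (p : Fin K → ℝ)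
    (v : Fin K → Fin d → ℝ) (η : ℝ) : ℕ → Matrix (Fin d) (Fin d) ℝ
  | 0 => 0
  | t + 1 => gd N μ p v η t - η • matrixGrad (loss N μ p v) (gd N μ p v η t)

end ICL

end

/-!
Since the features are orthonormal and the task weights are isotropic, the expected squared error
of a prompt with query `v k` is `∑ n, (A n - [n = k]) ^ 2`, where `A` is the vector of attention
scores. It depends on the parameter only through the logits `u n = v n ⬝ᵥ Q *ᵥ v k`, and gradient
descent on `L` acts on the logits of each query `k` separately, as gradient descent on `ℒ_k` with
step size `η * p k` started at `0` (`logit_gd_succ`). The drift of `u k` is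
`𝔼 [A k * ∑ n, (A n - [n = k]) ^ 2] ≥ 0`, and that of another logit `u n` is
`𝔼 [A n * (∑ m, A m ^ 2 - A k - A n)]`.

All token frequencies are within a constant factor of the `p n` outside an event of probability
`exp (-c N / K ^ 2)` (`le_sum_typical`). This is so small that atypical prompts do not matter for
any admissible precision, and on typical prompts everything is a deterministic comparison.

* If `A k` is the largest attention score, the other logits do not grow, while `u k` grows at a
  rate of at least `A k` times twice the loss. So the loss stays above `ε` only until `u k` has
  reached `log (ε ^ (-1 / 2))` up to a logarithm of the frequency of `k`
  (`exists_colLoss_le_of_dominance`). For the dominant feature this applies from the start.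
* For a rare feature, first `u k` has to grow to `log K` plus a constant. Until then `A k` is at
  least of order `1 / K` and the loss is of order one, which takes `K ^ 2 * log K / η` steps. The
  other logits move little: with `Y := 𝔼 [A D ^ 2]`, where `D` is the dominant feature, and `X` the
  drift of `u k`, the drift of a rare logit is of order at most `(X + Y) / K`, and that of `u D` is
  at most `-q * Y` plus a term of order `X / K`. As the decrease of `u D` matters only down to
  `-log K`, the total displacement of a rare logit is of order `log K / K`
  (`exists_early_exit`).

The attention deficits `1 - A k` on two typical prompts agree up to a constant factor, so a small
loss makes all of them small (`sq_one_sub_softAttn_le`). The infimum of `ℒ_k` is governed by the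
probability `(1 - p k) ^ N` that the feature `k` is absent from the prompt.
-/

noncomputable section

namespace ICL

open MeasureTheory Filter

/-! ### Softmax attention and its gradient -/

section gradient

variable {ι Ω : Type*} [Fintype ι] [Fintype Ω]

/-- Softmax attention with logits `u`, where `w n` is the weight (relative frequency) of `n`. -/
def softAttn (w u : ι → ℝ) (n : ι) : ℝ :=
  w n * Real.exp (u n) / ∑ m, w m * Real.exp (u m)

lemma hasDerivAt_softAttn {w u : ι → ℝ} (e : ι → ℝ) (n : ι)
    (hZ : ∑ m, w m * Real.exp (u m) ≠ 0) :
    HasDerivAt (fun h : ℝ => softAttn w (fun m => u m + h * e m) n)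
      (softAttn w u n * (e n - ∑ m, softAttn w u m * e m)) 0 := by
  have h1 : ∀ m, HasDerivAt (fun h : ℝ => w m * Real.exp (u m + h * e m))
      (w m * Real.exp (u m) * e m) 0 := by
    intro m
    have h2 : HasDerivAt (fun h : ℝ => u m + h * e m) (e m) 0 := by
      simpa using ((hasDerivAt_id (0 : ℝ)).mul_const (e m)).const_add (u m)
    have := (h2.exp).const_mul (w m)
    simpa [mul_assoc] using this
  have hS : HasDerivAt (fun h : ℝ => ∑ m, w m * Real.exp (u m + h * e m))
      (∑ m, w m * Real.exp (u m) * e m) 0 := HasDerivAt.fun_sum fun m _ => h1 m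
  have := (h1 n).div hS (by simpa using hZ)
  refine this.congr_deriv ?_
  simp only [softAttn, zero_mul, add_zero]
  have : ∑ m, w m * Real.exp (u m) / (∑ m, w m * Real.exp (u m)) * e m
      = (∑ m, w m * Real.exp (u m) * e m) / ∑ m, w m * Real.exp (u m) := by
    rw [Finset.sum_div]
    exact Finset.sum_congr rfl fun m _ => by ring
  rw [this]
  field_simp

variable [DecidableEq ι]

/-- The squared distance from `A` to the `k`-th basis vector. -/
def sqDist (k : ι) (A : ι → ℝ) : ℝ := ∑ n, (A n - if n = k then 1 else 0) ^ 2

/-- The `n`-th component of minus the gradient of `sqDist k / 2`, composed with the softmax, with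
respect to the logits; `A` is the value of the softmax. -/
def pull (k : ι) (A : ι → ℝ) (n : ι) : ℝ :=
  A n * (∑ m, A m * (A m - if m = k then 1 else 0) - (A n - if n = k then 1 else 0))

/-- The loss for the query `k` as a function of the logits, when the weights are `w s` with
probability `P s`. -/
def colLoss (P : Ω → ℝ) (w : Ω → ι → ℝ) (k : ι) (u : ι → ℝ) : ℝ :=
  1 / 2 * ∑ s, P s * sqDist k (softAttn (w s) u)

/-- Minus the gradient of `colLoss`. -/
def force (P : Ω → ℝ) (w : Ω → ι → ℝ) (k : ι) (u : ι → ℝ) (n : ι) : ℝ :=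
  ∑ s, P s * pull k (softAttn (w s) u) n

lemma hasDerivAt_colLoss {P : Ω → ℝ} {w : Ω → ι → ℝ} (k : ι) {u : ι → ℝ} (e : ι → ℝ)
    (hZ : ∀ s, ∑ m, w s m * Real.exp (u m) ≠ 0) :
    HasDerivAt (fun h : ℝ => colLoss P w k (fun m => u m + h * e m))
      (-∑ n, e n * force P w k u n) 0 := by
  have h1 : ∀ s, HasDerivAt (fun h : ℝ => P s * sqDist k (softAttn (w s) fun m => u m + h * e m))
      (P s * ∑ n, 2 * (softAttn (w s) u n - if n = k then 1 else 0) *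
        (softAttn (w s) u n * (e n - ∑ m, softAttn (w s) u m * e m))) 0 := by
    intro s
    refine HasDerivAt.const_mul _ (HasDerivAt.fun_sum fun n _ => ?_)
    have := ((hasDerivAt_softAttn e n (hZ s)).sub_const (if n = k then (1 : ℝ) else 0)).pow 2
    refine this.congr_deriv ?_
    simp
  refine ((HasDerivAt.fun_sum fun s _ => h1 s).const_mul (1 / 2 : ℝ)).congr_deriv ?_
  have h2 : ∀ s, 1 / 2 * (P s * ∑ n, 2 * (softAttn (w s) u n - if n = k then 1 else 0) *
      (softAttn (w s) u n * (e n - ∑ m, softAttn (w s) u m * e m)))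
        = -∑ n, e n * (P s * pull k (softAttn (w s) u) n) := by
    intro s
    set A := softAttn (w s) u
    have h3 : ∑ n, 2 * (A n - if n = k then 1 else 0) * (A n * (e n - ∑ m, A m * e m))
        = 2 * (∑ n, e n * (A n * (A n - if n = k then 1 else 0))
          - (∑ n, A n * (A n - if n = k then 1 else 0)) * ∑ m, A m * e m) := by
      rw [Finset.sum_mul, ← Finset.sum_sub_distrib, Finset.mul_sum]
      exact Finset.sum_congr rfl fun n _ => by ring
    have h4 : ∑ n, e n * (P s * pull k A n)
        = P s * ((∑ n, A n * (A n - if n = k then 1 else 0)) * ∑ m, A m * e m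
          - ∑ n, e n * (A n * (A n - if n = k then 1 else 0))) := by
      rw [Finset.mul_sum Finset.univ _ (∑ n, A n * (A n - if n = k then 1 else 0)),
        ← Finset.sum_sub_distrib, Finset.mul_sum]
      exact Finset.sum_congr rfl fun n _ => by rw [pull]; ring
    rw [h3, h4]
    ring
  rw [Finset.mul_sum, Finset.sum_congr rfl fun s _ => h2 s, Finset.sum_neg_distrib,
    Finset.sum_comm]
  simp only [force, Finset.mul_sum]

end gradient

/-! ### Reduction of the transformer to logits -/

/-- The relative frequency of the feature `n` among the tokens. -/
def freq {K N : ℕ} (s : Fin N → Fin K) (n : Fin K) : ℝ :=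
  ((Finset.univ.filter fun i => s i = n).card : ℝ) / N

/-- The logit of the feature `n` for the query `k`. -/
def logit {d K : ℕ} (v : Fin K → Fin d → ℝ) (Q : Matrix (Fin d) (Fin d) ℝ) (k n : Fin K) : ℝ :=
  v n ⬝ᵥ Q *ᵥ v k

section prompt

variable {d K N : ℕ}

lemma freq_nonneg (s : Fin N → Fin K) (n : Fin K) : 0 ≤ freq s n := by
  unfold freq; positivity

lemma sum_freq_mul (s : Fin N → Fin K) (f : Fin K → ℝ) :
    ∑ n, freq s n * f n = (∑ i, f (s i)) / N := by
  rw [← Finset.sum_fiberwise (g := s), Finset.sum_div]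
  refine Finset.sum_congr rfl fun n _ => ?_
  rw [Finset.sum_congr rfl (g := fun _ => f n)]
  · simp [freq]; ring
  · intro i hi; simp at hi; rw [hi]

lemma sum_freq (hN : 0 < N) (s : Fin N → Fin K) : ∑ n, freq s n = 1 := by
  have := sum_freq_mul s fun _ => 1
  simpa [hN.ne'] using this

lemma tokenAttn_eq (v : Fin K → Fin d → ℝ) (Q : Matrix (Fin d) (Fin d) ℝ) (s : Fin N → Fin K)
    (k : Fin K) (i : Fin N) :
    tokenAttn v Q s k i = Real.exp (logit v Q k (s i)) / ∑ l, Real.exp (logit v Q k (s l)) := by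
  have h : ∀ i, ((mask (embX (fun i => v (s i)) (v k)))ᵀ * Q * embX (fun i => v (s i)) (v k)) i
      (Fin.last N) = logit v Q k (s i) := by
    intro i
    rw [logit, Matrix.dotProduct_mulVec]
    simp only [Matrix.mul_apply, mask, embX, Matrix.transpose_apply, Matrix.submatrix_apply, id,
      Matrix.of_apply, Fin.snoc_castSucc, Fin.snoc_last, dotProduct, Matrix.vecMul]
  simp only [tokenAttn, attnMatrix, softmaxCols, Matrix.of_apply, h]

lemma featureAttn_eq (hN : 0 < N) (v : Fin K → Fin d → ℝ) (Q : Matrix (Fin d) (Fin d) ℝ)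
    (s : Fin N → Fin K) (k n : Fin K) :
    featureAttn v Q s k n = softAttn (freq s) (logit v Q k) n := by
  simp only [featureAttn, tokenAttn_eq, softAttn, sum_freq_mul s fun n => Real.exp (logit v Q k n)]
  rw [Finset.sum_congr rfl (g := fun _ => Real.exp (logit v Q k n) /
    ∑ l, Real.exp (logit v Q k (s l)))]
  · have : (N : ℝ) ≠ 0 := by positivity
    simp only [Finset.sum_const, nsmul_eq_mul, freq]
    field_simp
  · intro i hi
    simp only [Finset.mem_filter] at hi
    rw [hi.2]

lemma prediction_eq (v : Fin K → Fin d → ℝ) (Q : Matrix (Fin d) (Fin d) ℝ) (w : Fin d → ℝ)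
    (s : Fin N → Fin K) (k : Fin K) :
    prediction v Q w s k = ∑ n, featureAttn v Q s k n * (w ⬝ᵥ v n) := by
  have : prediction v Q w s k = ∑ i, tokenAttn v Q s k i * (w ⬝ᵥ v (s i)) := by
    simp only [prediction, FSA, Matrix.mul_apply, mask, embY, Matrix.submatrix_apply,
      Matrix.of_apply, Fin.snoc_castSucc, tokenAttn, id]
    exact Finset.sum_congr rfl fun i _ => mul_comm _ _
  rw [this, ← Finset.sum_fiberwise (g := s)]
  refine Finset.sum_congr rfl fun n _ => ?_
  rw [featureAttn, Finset.sum_mul]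
  refine Finset.sum_congr rfl fun i hi => ?_
  simp only [Finset.mem_filter] at hi
  rw [hi.2]

/-- Second moments of linear functionals under a task distribution. -/
lemma IsTaskDistribution.integral_sq {μ : Measure (Fin d → ℝ)} (hμ : IsTaskDistribution μ)
    (z : Fin d → ℝ) : ∫ w, (w ⬝ᵥ z) ^ 2 ∂μ = z ⬝ᵥ z := by
  have hint : ∀ i j, Integrable (fun w : Fin d → ℝ => w i * w j) μ := fun i j =>
    (hμ.memLp i).integrable_mul (hμ.memLp j)
  have h1 : ∀ w : Fin d → ℝ, (w ⬝ᵥ z) ^ 2 = ∑ i, ∑ j, z i * z j * (w i * w j) := by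
    intro w
    rw [dotProduct, sq, Finset.sum_mul_sum]
    exact Finset.sum_congr rfl fun i _ => Finset.sum_congr rfl fun j _ => by ring
  simp only [h1]
  rw [integral_finsetSum _ fun i _ => integrable_finsetSum _ fun j _ => (hint i j).const_mul _]
  refine Finset.sum_congr rfl fun i _ => ?_
  rw [integral_finsetSum _ fun j _ => (hint i j).const_mul _]
  simp [integral_const_mul, hμ.covariance]

/-- Averaged over the task, the squared error is the squared distance of the attention scores from
full attention on the query. -/
lemma integral_sqError (hN : 0 < N) {μ : Measure (Fin d → ℝ)} (hμ : IsTaskDistribution μ)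
    {v : Fin K → Fin d → ℝ} (hv : OrthonormalFeatures v) (Q : Matrix (Fin d) (Fin d) ℝ)
    (s : Fin N → Fin K) (k : Fin K) :
    ∫ w, sqError v Q w s k ∂μ = sqDist k (softAttn (freq s) (logit v Q k)) := by
  set A := softAttn (freq s) (logit v Q k) with hA
  set B : Fin K → ℝ := fun n => A n - if n = k then 1 else 0 with hB
  have h1 : ∀ w, sqError v Q w s k = (w ⬝ᵥ ∑ n, B n • v n) ^ 2 := by
    intro w
    simp only [sqError, prediction_eq, featureAttn_eq hN, ← hA, dotProduct_sum, dotProduct_smul,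
      hB, smul_eq_mul, sub_mul, Finset.sum_sub_distrib, ite_mul, one_mul, zero_mul,
      Finset.sum_ite_eq', Finset.mem_univ, if_true]
  simp only [h1, hμ.integral_sq, sqDist]
  simp only [dotProduct_sum, sum_dotProduct, dotProduct_smul, smul_dotProduct, hv _ _, smul_eq_mul,
    mul_ite, mul_one, mul_zero, Finset.sum_ite_eq', Finset.mem_univ, if_true]
  exact Finset.sum_congr rfl fun n _ => (sq _).symm

lemma loss_eq (hN : 0 < N) {μ : Measure (Fin d → ℝ)} (hμ : IsTaskDistribution μ)
    {v : Fin K → Fin d → ℝ} (hv : OrthonormalFeatures v) (p : Fin K → ℝ)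
    (Q : Matrix (Fin d) (Fin d) ℝ) :
    loss N μ p v Q = ∑ k, p k * colLoss (seqProb p) (freq (N := N)) k (logit v Q k) := by
  simp only [loss, promptExp, integral_sqError hN hμ hv, colLoss, Finset.mul_sum]
  exact Finset.sum_congr rfl fun k _ => Finset.sum_congr rfl fun s _ => by ring

lemma condLoss_eq (hN : 0 < N) {μ : Measure (Fin d → ℝ)} (hμ : IsTaskDistribution μ)
    {v : Fin K → Fin d → ℝ} (hv : OrthonormalFeatures v) {p : Fin K → ℝ} {k : Fin K}
    (hk : p k ≠ 0) (Q : Matrix (Fin d) (Fin d) ℝ) :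
    condLoss N μ p v k Q = colLoss (seqProb p) (freq (N := N)) k (logit v Q k) := by
  have : ∀ (q : Fin K) (s : Fin N → Fin K),
      ∫ w, (if q = k then sqError v Q w s q else 0) ∂μ
        = if q = k then sqDist k (softAttn (freq s) (logit v Q k)) else 0 := by
    intro q s
    split_ifs with h
    · rw [h, integral_sqError hN hμ hv]
    · simp
  simp only [condLoss, promptExp, this, colLoss, mul_ite, mul_zero]
  rw [Finset.sum_comm]
  simp only [Finset.sum_ite_eq', Finset.mem_univ, if_true, mul_assoc, ← Finset.mul_sum]
  field_simp

lemma sum_freq_exp_pos (hN : 0 < N) (s : Fin N → Fin K) (u : Fin K → ℝ) :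
    0 < ∑ n, freq s n * Real.exp (u n) := by
  rw [sum_freq_mul s fun n => Real.exp (u n)]
  have : Nonempty (Fin N) := ⟨⟨0, hN⟩⟩
  have : 0 < ∑ i, Real.exp (u (s i)) := Finset.sum_pos (fun i _ => Real.exp_pos _) (by simp)
  positivity

lemma matrixGrad_loss (hN : 0 < N) {μ : Measure (Fin d → ℝ)} (hμ : IsTaskDistribution μ)
    {v : Fin K → Fin d → ℝ} (hv : OrthonormalFeatures v) (p : Fin K → ℝ)
    (Q : Matrix (Fin d) (Fin d) ℝ) (i j : Fin d) :
    matrixGrad (loss N μ p v) Q i j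
      = -∑ k, ∑ n, v n i * v k j *
          (p k * force (seqProb p) (freq (N := N)) k (logit v Q k) n) := by
  have h1 : ∀ (h : ℝ) (k : Fin K), logit v (Q + h • Matrix.single i j (1 : ℝ)) k
      = fun n => logit v Q k n + h * (v n i * v k j) := by
    intro h k
    funext n
    simp only [logit, Matrix.add_mulVec, dotProduct_add, Matrix.smul_mulVec, dotProduct_smul,
      smul_eq_mul, Matrix.single_mulVec]
    simp [Function.update_apply, dotProduct]
  simp only [matrixGrad, Matrix.of_apply, loss_eq hN hμ hv, h1]
  have := HasDerivAt.fun_sum (u := Finset.univ) fun (k : Fin K) _ =>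
    (hasDerivAt_colLoss (P := seqProb p) (w := freq (N := N)) k (u := logit v Q k)
      (fun n => v n i * v k j) fun s => (sum_freq_exp_pos hN s _).ne').const_mul (p k)
  rw [this.deriv]
  simp only [Finset.mul_sum, ← Finset.sum_neg_distrib, mul_neg]
  exact Finset.sum_congr rfl fun k _ => Finset.sum_congr rfl fun n _ => by ring

/-- Gradient descent on the population loss moves the logits of each query `k` along minus the
gradient of the loss conditioned on this query. -/
lemma logit_gd_succ (hN : 0 < N) {μ : Measure (Fin d → ℝ)} (hμ : IsTaskDistribution μ)
    {v : Fin K → Fin d → ℝ} (hv : OrthonormalFeatures v) (p : Fin K → ℝ) (η : ℝ) (t : ℕ)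
    (k n : Fin K) :
    logit v (gd N μ p v η (t + 1)) k n = logit v (gd N μ p v η t) k n
      + η * p k * force (seqProb p) (freq (N := N)) k (logit v (gd N μ p v η t) k) n := by
  set Q := gd N μ p v η t with hQ
  set F : Fin K → Fin K → ℝ := fun k n =>
    p k * force (seqProb p) (freq (N := N)) k (logit v Q k) n with hF
  have h1 : matrixGrad (loss N μ p v) Q
      = -∑ k, ∑ n, F k n • Matrix.vecMulVec (v n) (v k) := by
    ext i j
    rw [matrixGrad_loss hN hμ hv]
    simp only [Matrix.neg_apply, Matrix.sum_apply, Matrix.smul_apply, Matrix.vecMulVec_apply,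
      smul_eq_mul, hF]
    congr 1
    exact Finset.sum_congr rfl fun k _ => Finset.sum_congr rfl fun n _ => by ring
  have h2 : v n ⬝ᵥ matrixGrad (loss N μ p v) Q *ᵥ v k = -F k n := by
    rw [h1, Matrix.neg_mulVec, dotProduct_neg]
    simp only [Matrix.sum_mulVec, dotProduct_sum, Matrix.smul_mulVec, dotProduct_smul,
      Matrix.vecMulVec_mulVec, hv _ _]
    simp
  rw [gd, ← hQ]
  simp only [logit, Matrix.sub_mulVec, dotProduct_sub, Matrix.smul_mulVec, dotProduct_smul, h2]
  simp only [hF, smul_eq_mul]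
  ring

lemma logit_gd_zero {μ : Measure (Fin d → ℝ)} (v : Fin K → Fin d → ℝ) (p : Fin K → ℝ) (η : ℝ)
    (k : Fin K) : logit v (gd N μ p v η 0) k = 0 := by
  funext n
  simp [logit, gd]

end prompt

/-! ### Expectations and forces under random weights -/

section randomWeights

variable {ι Ω : Type*} [Fintype ι] [Fintype Ω]

/-- The vector `A` is a probability distribution. -/
structure IsDistribution (A : ι → ℝ) : Prop where
  nonneg : ∀ n, 0 ≤ A n
  sum_eq_one : ∑ n, A n = 1

lemma IsDistribution.le_one {A : ι → ℝ} (hA : IsDistribution A) (n : ι) : A n ≤ 1 := by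
  rw [← hA.sum_eq_one]
  exact Finset.single_le_sum (fun m _ => hA.nonneg m) (Finset.mem_univ n)

lemma sum_sq_le_mul_sum {A : ι → ℝ} (hA : IsDistribution A) (S : Finset ι) {B : ℝ}
    (hB : ∀ m ∈ S, A m ≤ B) : ∑ m ∈ S, A m ^ 2 ≤ B * ∑ m ∈ S, A m := by
  rw [Finset.mul_sum]
  refine Finset.sum_le_sum fun m hm => ?_
  rw [sq]
  exact mul_le_mul_of_nonneg_right (hB m hm) (hA.nonneg m)

lemma IsDistribution.sum_sq_le_one {A : ι → ℝ} (hA : IsDistribution A) : ∑ m, A m ^ 2 ≤ 1 := by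
  simpa [hA.sum_eq_one] using sum_sq_le_mul_sum hA Finset.univ fun m _ => hA.le_one m

lemma IsDistribution.partition_pos {w : ι → ℝ} (hw : IsDistribution w) (u : ι → ℝ) :
    0 < ∑ m, w m * Real.exp (u m) := by
  have h0 : ∀ m ∈ Finset.univ, 0 ≤ w m * Real.exp (u m) := fun m _ =>
    mul_nonneg (hw.nonneg m) (Real.exp_pos _).le
  refine lt_of_le_of_ne (Finset.sum_nonneg h0) fun h => ?_
  have h1 := (Finset.sum_eq_zero_iff_of_nonneg h0).1 h.symm
  have h2 : ∀ m, w m = 0 := fun m => by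
    simpa [(Real.exp_pos (u m)).ne'] using h1 m (Finset.mem_univ m)
  simpa [h2] using hw.sum_eq_one

lemma isDistribution_softAttn {w : ι → ℝ} (hw : IsDistribution w) (u : ι → ℝ) :
    IsDistribution (softAttn w u) where
  nonneg n := div_nonneg (mul_nonneg (hw.nonneg n) (Real.exp_pos _).le) (hw.partition_pos u).le
  sum_eq_one := by
    simp only [softAttn]
    rw [← Finset.sum_div, div_self (hw.partition_pos u).ne']

variable [DecidableEq ι]

lemma sqDist_eq (k : ι) (A : ι → ℝ) : sqDist k A = ∑ m, A m ^ 2 - 2 * A k + 1 := by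
  have : ∀ n, (A n - if n = k then 1 else 0) ^ 2
      = A n ^ 2 - 2 * (if n = k then A k else 0) + if n = k then 1 else 0 := by
    intro n
    split_ifs with h
    · rw [h]; ring
    · ring
  simp [sqDist, this, Finset.sum_add_distrib, Finset.sum_sub_distrib]

lemma sum_mul_sub_indicator (k : ι) (A : ι → ℝ) :
    ∑ m, A m * (A m - if m = k then 1 else 0) = ∑ m, A m ^ 2 - A k := by
  simp [mul_sub, Finset.sum_sub_distrib, sq]

lemma pull_self (k : ι) (A : ι → ℝ) : pull k A k = A k * sqDist k A := by
  rw [pull, sum_mul_sub_indicator, sqDist_eq, if_pos rfl]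
  ring

lemma pull_of_ne {k n : ι} (h : n ≠ k) (A : ι → ℝ) :
    pull k A n = A n * (∑ m, A m ^ 2 - A k - A n) := by
  rw [pull, sum_mul_sub_indicator, if_neg h, sub_zero]

lemma sqDist_nonneg (k : ι) (A : ι → ℝ) : 0 ≤ sqDist k A :=
  Finset.sum_nonneg fun _ _ => sq_nonneg _

lemma sq_one_sub_le_sqDist (k : ι) (A : ι → ℝ) : (1 - A k) ^ 2 ≤ sqDist k A := by
  have := Finset.single_le_sum (f := fun n => (A n - if n = k then 1 else 0) ^ 2)
    (fun n _ => sq_nonneg _) (Finset.mem_univ k)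
  simp only [if_true] at this
  calc (1 - A k) ^ 2 = (A k - 1) ^ 2 := by ring
    _ ≤ _ := this

lemma IsDistribution.add_le_one {A : ι → ℝ} (hA : IsDistribution A) {m n : ι} (h : m ≠ n) :
    A m + A n ≤ 1 := by
  rw [← hA.sum_eq_one, ← Finset.sum_pair h]
  exact Finset.sum_le_sum_of_subset_of_nonneg (Finset.subset_univ _) fun i _ _ => hA.nonneg i

lemma IsDistribution.sum_erase {A : ι → ℝ} (hA : IsDistribution A) (k : ι) :
    ∑ m ∈ Finset.univ.erase k, A m = 1 - A k := by
  have := Finset.add_sum_erase Finset.univ A (Finset.mem_univ k)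
  rw [hA.sum_eq_one] at this
  linarith

lemma sqDist_le {A : ι → ℝ} (hA : IsDistribution A) (k : ι) :
    sqDist k A ≤ 2 * (1 - A k) ^ 2 := by
  have h1 := Finset.add_sum_erase Finset.univ (fun m => A m ^ 2) (Finset.mem_univ k)
  have h2 : ∑ m ∈ Finset.univ.erase k, A m ^ 2 ≤ (1 - A k) * ∑ m ∈ Finset.univ.erase k, A m :=
    sum_sq_le_mul_sum hA _ fun m hm => by
      linarith [hA.add_le_one (Finset.ne_of_mem_erase hm)]
  rw [hA.sum_erase] at h2
  rw [sqDist_eq]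
  nlinarith

lemma sqDist_le_two {A : ι → ℝ} (hA : IsDistribution A) (k : ι) : sqDist k A ≤ 2 := by
  have := sqDist_le hA k
  nlinarith [hA.nonneg k, hA.le_one k]

lemma abs_pull_le_one {A : ι → ℝ} (hA : IsDistribution A) {k n : ι} (h : n ≠ k) :
    |pull k A n| ≤ 1 := by
  rw [pull_of_ne h, abs_mul]
  have h1 := hA.sum_sq_le_one
  have h2 : 0 ≤ ∑ m, A m ^ 2 := Finset.sum_nonneg fun m _ => sq_nonneg _
  have h3 := hA.add_le_one h
  refine mul_le_one₀ ?_ (abs_nonneg _) ?_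
  · rw [abs_of_nonneg (hA.nonneg n)]; exact hA.le_one n
  · rw [abs_le]
    constructor <;> linarith [hA.nonneg n, hA.nonneg k]

lemma pull_self_nonneg {A : ι → ℝ} (hA : IsDistribution A) (k : ι) : 0 ≤ pull k A k := by
  rw [pull_self]
  exact mul_nonneg (hA.nonneg k) (sqDist_nonneg k A)

lemma pull_self_le_two {A : ι → ℝ} (hA : IsDistribution A) (k : ι) : pull k A k ≤ 2 := by
  rw [pull_self]
  nlinarith [hA.nonneg k, hA.le_one k, sqDist_nonneg k A, sqDist_le_two hA k]

/-- Random weights: `P` is a probability distribution and so is `w s` for each outcome `s`. -/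
structure IsRandomWeights (P : Ω → ℝ) (w : Ω → ι → ℝ) : Prop where
  prob : IsDistribution P
  weight : ∀ s, IsDistribution (w s)

section expectation

variable {P : Ω → ℝ} {G : Finset Ω} {δ : ℝ}

omit [DecidableEq ι] in
lemma IsRandomWeights.attn {w : Ω → ι → ℝ} (hPw : IsRandomWeights P w) (u : ι → ℝ) (s : Ω) :
    IsDistribution (softAttn (w s) u) := isDistribution_softAttn (hPw.weight s) u

/-- An event of probability at least `1 - δ` carries the expectation up to `B * δ`. -/
lemma expectation_le_add (hP : IsDistribution P) (hG : 1 - δ ≤ ∑ s ∈ G, P s) {f : Ω → ℝ} {B : ℝ}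
    (hB : 0 ≤ B) (hf : ∀ s, f s ≤ B) : ∑ s, P s * f s ≤ ∑ s ∈ G, P s * f s + B * δ := by
  have h : ∑ s ∈ G, P s * (B - f s) ≤ ∑ s, P s * (B - f s) :=
    Finset.sum_le_sum_of_subset_of_nonneg (Finset.subset_univ _) fun s _ _ =>
      mul_nonneg (hP.nonneg s) (sub_nonneg.2 (hf s))
  simp only [mul_sub, Finset.sum_sub_distrib, ← Finset.sum_mul, hP.sum_eq_one] at h
  nlinarith

lemma expectation_restrict_le (hP : IsDistribution P) {f : Ω → ℝ} (hf : ∀ s, 0 ≤ f s) :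
    ∑ s ∈ G, P s * f s ≤ ∑ s, P s * f s :=
  Finset.sum_le_sum_of_subset_of_nonneg (Finset.subset_univ _) fun s _ _ =>
    mul_nonneg (hP.nonneg s) (hf s)

lemma expectation_restrict_le_const (hP : IsDistribution P) {f : Ω → ℝ} {B : ℝ} (hB : 0 ≤ B)
    (hf : ∀ s ∈ G, f s ≤ B) : ∑ s ∈ G, P s * f s ≤ B := by
  calc ∑ s ∈ G, P s * f s ≤ ∑ s ∈ G, P s * B :=
        Finset.sum_le_sum fun s hs => mul_le_mul_of_nonneg_left (hf s hs) (hP.nonneg s)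
    _ ≤ ∑ s, P s * B := expectation_restrict_le hP fun _ => hB
    _ = B := by rw [← Finset.sum_mul, hP.sum_eq_one, one_mul]

lemma const_le_expectation_restrict (hP : IsDistribution P) (hG : 1 - δ ≤ ∑ s ∈ G, P s)
    {f : Ω → ℝ} {B : ℝ} (hB : 0 ≤ B) (hf : ∀ s ∈ G, B ≤ f s) :
    (1 - δ) * B ≤ ∑ s ∈ G, P s * f s := by
  calc (1 - δ) * B ≤ (∑ s ∈ G, P s) * B := mul_le_mul_of_nonneg_right hG hB
    _ = ∑ s ∈ G, P s * B := Finset.sum_mul _ _ _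
    _ ≤ _ := Finset.sum_le_sum fun s hs => mul_le_mul_of_nonneg_left (hf s hs) (hP.nonneg s)

end expectation

section force

variable {P : Ω → ℝ} {w : Ω → ι → ℝ} {G : Finset Ω} {δ : ℝ} (hPw : IsRandomWeights P w)
include hPw

lemma force_self_le_two (k : ι) (u : ι → ℝ) : force P w k u k ≤ 2 :=
  expectation_restrict_le_const hPw.prob zero_le_two fun s _ => pull_self_le_two (hPw.attn u s) k

lemma colLoss_nonneg (k : ι) (u : ι → ℝ) : 0 ≤ colLoss P w k u :=
  mul_nonneg (by norm_num)
    (Finset.sum_nonneg fun s _ => mul_nonneg (hPw.prob.nonneg s) (sqDist_nonneg k _))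

/-- The loss is controlled by the attention deficit on an event of high probability. -/
lemma colLoss_le (hG : 1 - δ ≤ ∑ s ∈ G, P s) (k : ι) (u : ι → ℝ) {r : ℝ}
    (hr : ∀ s ∈ G, 1 - softAttn (w s) u k ≤ r) : colLoss P w k u ≤ r ^ 2 + δ := by
  have h1 := expectation_le_add hPw.prob hG zero_le_two fun s => sqDist_le_two (hPw.attn u s) k
  have h2 : ∑ s ∈ G, P s * sqDist k (softAttn (w s) u) ≤ 2 * r ^ 2 :=
    expectation_restrict_le_const hPw.prob (by positivity) fun s hs => by
      have h3 := sqDist_le (hPw.attn u s) k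
      have h4 := (hPw.attn u s).le_one k
      have h5 := hr s hs
      nlinarith
  rw [colLoss]
  linarith

/-- The logit of the target grows at a rate proportional to the loss. -/
lemma le_force_self (hG : 1 - δ ≤ ∑ s ∈ G, P s) (k : ι) (u : ι → ℝ) {θ : ℝ} (hθ : 0 ≤ θ)
    (h : ∀ s ∈ G, θ ≤ softAttn (w s) u k) : θ * (2 * colLoss P w k u - 2 * δ) ≤ force P w k u k := by
  have h1 := expectation_le_add hPw.prob hG zero_le_two fun s => sqDist_le_two (hPw.attn u s) k
  have h2 : θ * ∑ s ∈ G, P s * sqDist k (softAttn (w s) u) ≤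
      ∑ s ∈ G, P s * pull k (softAttn (w s) u) k := by
    rw [Finset.mul_sum]
    refine Finset.sum_le_sum fun s hs => ?_
    rw [pull_self, mul_left_comm]
    exact mul_le_mul_of_nonneg_left
      (mul_le_mul_of_nonneg_right (h s hs) (sqDist_nonneg k _)) (hPw.prob.nonneg s)
  have h3 : ∑ s ∈ G, P s * pull k (softAttn (w s) u) k ≤ force P w k u k :=
    expectation_restrict_le hPw.prob fun s => pull_self_nonneg (hPw.attn u s) k
  refine le_trans ?_ (h2.trans h3)
  refine mul_le_mul_of_nonneg_left ?_ hθ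
  rw [colLoss]
  linarith

/-- A restricted upper bound for the force suffices, up to the probability of the rest. -/
lemma force_le (hG : 1 - δ ≤ ∑ s ∈ G, P s) {k n : ι} (h : n ≠ k) (u : ι → ℝ) :
    force P w k u n ≤ ∑ s ∈ G, P s * pull k (softAttn (w s) u) n + δ := by
  have h1 := expectation_le_add hPw.prob hG zero_le_one fun s =>
    (abs_le.1 (abs_pull_le_one (hPw.attn u s) h)).2
  rwa [one_mul] at h1

lemma abs_force_le (hG : 1 - δ ≤ ∑ s ∈ G, P s) {k n : ι} (h : n ≠ k) (u : ι → ℝ) :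
    |force P w k u n| ≤ ∑ s ∈ G, P s * |pull k (softAttn (w s) u) n| + δ := by
  have h1 := expectation_le_add hPw.prob hG zero_le_one fun s =>
    abs_pull_le_one (hPw.attn u s) h
  refine le_trans (Finset.abs_sum_le_sum_abs _ _) ?_
  simpa [abs_mul, abs_of_nonneg (hPw.prob.nonneg _)] using h1

lemma abs_force_le_one {k n : ι} (h : n ≠ k) (u : ι → ℝ) : |force P w k u n| ≤ 1 := by
  have := abs_force_le hPw (G := Finset.univ) (δ := 0) (by simp [hPw.prob.sum_eq_one]) h u
  refine this.trans ?_
  rw [add_zero]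
  exact expectation_restrict_le_const hPw.prob zero_le_one fun s _ =>
    abs_pull_le_one (hPw.attn u s) h

end force

/-! ### Convergence once the target dominates -/

section dominance

variable {w u : ι → ℝ} {k : ι}

lemma exp_one_lt_three : Real.exp 1 < 3 := Real.exp_one_lt_d9.trans (by norm_num)

lemma exp_two_lt_nine : Real.exp 2 < 9 := by
  have h : Real.exp 2 = Real.exp 1 ^ 2 := by rw [← Real.exp_nat_mul]; norm_num
  rw [h]
  nlinarith [exp_one_lt_three, Real.exp_pos 1]

omit [DecidableEq ι] in
lemma IsDistribution.sum_mul_le {w : ι → ℝ} (hw : IsDistribution w) (S : Finset ι) {f : ι → ℝ}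
    {B : ℝ} (hB : 0 ≤ B) (hf : ∀ m ∈ S, f m ≤ B) : ∑ m ∈ S, w m * f m ≤ B :=
  expectation_restrict_le_const hw hB hf

lemma partition_eq (w u : ι → ℝ) (k : ι) : ∑ m, w m * Real.exp (u m) =
    w k * Real.exp (u k) + ∑ m ∈ Finset.univ.erase k, w m * Real.exp (u m) :=
  (Finset.add_sum_erase Finset.univ _ (Finset.mem_univ k)).symm

lemma one_sub_softAttn (hw : IsDistribution w) (u : ι → ℝ) (k : ι) : 1 - softAttn w u k =
    (∑ m ∈ Finset.univ.erase k, w m * Real.exp (u m)) / ∑ m, w m * Real.exp (u m) := by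
  have h := hw.partition_pos u
  rw [softAttn, eq_div_iff h.ne', sub_mul, div_mul_cancel₀ _ h.ne', partition_eq w u k]
  ring

lemma rest_le_nine (hw : IsDistribution w) (hu : ∀ m, m ≠ k → u m ≤ 2) :
    ∑ m ∈ Finset.univ.erase k, w m * Real.exp (u m) ≤ 9 :=
  hw.sum_mul_le _ (by norm_num) fun m hm =>
    (Real.exp_le_exp.2 (hu m (Finset.ne_of_mem_erase hm))).trans exp_two_lt_nine.le

lemma rest_nonneg (hw : IsDistribution w) (u : ι → ℝ) (k : ι) :
    0 ≤ ∑ m ∈ Finset.univ.erase k, w m * Real.exp (u m) :=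
  Finset.sum_nonneg fun m _ => mul_nonneg (hw.nonneg m) (Real.exp_pos _).le

lemma one_sub_softAttn_le (hw : IsDistribution w) (hu : ∀ m, m ≠ k → u m ≤ 2) {x : ℝ}
    (hx : 0 < x) (hxk : x ≤ w k * Real.exp (u k)) : 1 - softAttn w u k ≤ 9 / x := by
  rw [one_sub_softAttn hw, partition_eq w u k]
  have h0 := rest_nonneg hw u k
  exact div_le_div₀ (by norm_num) (rest_le_nine hw hu) hx (by linarith)

lemma le_softAttn (hw : IsDistribution w) (hu : ∀ m, m ≠ k → u m ≤ 2) {x θ : ℝ}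
    (hxk : x ≤ w k * Real.exp (u k)) (hθ : 0 ≤ θ) (hθ1 : θ ≤ 1) (hθx : θ * (x + 9) ≤ x) :
    θ ≤ softAttn w u k := by
  rw [softAttn, le_div_iff₀ (hw.partition_pos u), partition_eq w u k]
  have h1 := rest_le_nine hw hu
  nlinarith

/-- If the target has the largest attention score, the other logits do not grow. -/
lemma pull_nonpos (hw : IsDistribution w) (h : ∀ m, w m * Real.exp (u m) ≤ w k * Real.exp (u k))
    {n : ι} (hn : n ≠ k) : pull k (softAttn w u) n ≤ 0 := by
  have hA := isDistribution_softAttn hw u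
  have h1 : ∑ m, softAttn w u m ^ 2 ≤ softAttn w u k * ∑ m, softAttn w u m :=
    sum_sq_le_mul_sum hA _ fun m _ =>
      div_le_div_of_nonneg_right (h m) (hw.partition_pos u).le
  rw [hA.sum_eq_one, mul_one] at h1
  rw [pull_of_ne hn]
  exact mul_nonpos_of_nonneg_of_nonpos (hA.nonneg n) (by linarith [hA.nonneg n])

end dominance

/-- `u` is a sequence of logits produced by gradient descent on `colLoss` with step size `h`. -/
def IsDescent (P : Ω → ℝ) (w : Ω → ι → ℝ) (k : ι) (h : ℝ) (u : ℕ → ι → ℝ) : Prop :=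
  ∀ t n, u (t + 1) n = u t n + h * force P w k (u t) n

/-- Once the target dominates all other features, gradient descent reaches a small loss. The logits
are only bounded above by `2` instead of their initial bound `1`, because of the contribution
`h * δ` of atypical outcomes in each step; the number `9` is an upper bound for `exp 2`. -/
theorem exists_colLoss_le_of_dominance {P : Ω → ℝ} {w : Ω → ι → ℝ} {G : Finset Ω} {k : ι}
    {δ h κ U θ ε : ℝ} {u : ℕ → ι → ℝ} (hPw : IsRandomWeights P w) (hG : 1 - δ ≤ ∑ s ∈ G, P s)
    (hu : IsDescent P w k h u) (h0 : 0 < h) (hκ : 0 < κ) (hκG : ∀ s ∈ G, κ ≤ w s k)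
    (hdom : ∀ s ∈ G, ∀ m, m ≠ k → 9 * w s m ≤ κ * Real.exp U)
    (hθ : 0 ≤ θ) (hθ1 : θ ≤ 1) (hθκ : θ * (κ * Real.exp U + 9) ≤ κ * Real.exp U)
    (hε : 0 < ε) (hδ0 : 0 ≤ δ) (hδε : 2 * δ ≤ ε) {t₀ M : ℕ} (hMδ : M * (h * δ) ≤ 1)
    (hstart : ∀ m, m ≠ k → u t₀ m ≤ 1) (hstartk : U ≤ u t₀ k)
    (hM : Real.log (18 / κ * ε ^ (-(1 / 2) : ℝ)) ≤ U + M * (h * (θ * ε))) :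
    ∃ t, t ≤ t₀ + M ∧ colLoss P w k (u t) ≤ ε := by
  by_contra! hcon
  have key : ∀ j ≤ M, (∀ m, m ≠ k → u (t₀ + j) m ≤ 1 + j * (h * δ)) ∧
      U + j * (h * (θ * ε)) ≤ u (t₀ + j) k := by
    intro j
    induction j with
    | zero => intro _; simpa using ⟨hstart, hstartk⟩
    | succ j ih =>
      intro hj
      obtain ⟨ih1, ih2⟩ := ih (by omega)
      have hjM : (j : ℝ) * (h * δ) ≤ 1 := le_trans
        (mul_le_mul_of_nonneg_right (by exact_mod_cast (by omega : j ≤ M)) (by positivity)) hMδ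
      have hu2 : ∀ m, m ≠ k → u (t₀ + j) m ≤ 2 := fun m hm => by linarith [ih1 m hm]
      have hUk : U ≤ u (t₀ + j) k := by
        have : 0 ≤ (j : ℝ) * (h * (θ * ε)) := by positivity
        linarith
      have hx : ∀ s ∈ G, κ * Real.exp U ≤ w s k * Real.exp (u (t₀ + j) k) := fun s hs =>
        mul_le_mul (hκG s hs) (Real.exp_le_exp.2 hUk) (Real.exp_pos _).le
          (hκ.le.trans (hκG s hs))
      constructor
      · intro m hm
        have h1 : force P w k (u (t₀ + j)) m ≤ δ := by
          refine (force_le hPw hG hm _).trans ?_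
          have : ∑ s ∈ G, P s * pull k (softAttn (w s) (u (t₀ + j))) m ≤ 0 := by
            refine Finset.sum_nonpos fun s hs => mul_nonpos_of_nonneg_of_nonpos
              (hPw.prob.nonneg s) (pull_nonpos (hPw.weight s) (fun n => ?_) hm)
            by_cases hn : n = k
            · rw [hn]
            · calc w s n * Real.exp (u (t₀ + j) n) ≤ w s n * 9 :=
                    mul_le_mul_of_nonneg_left ((Real.exp_le_exp.2 (hu2 n hn)).trans
                      exp_two_lt_nine.le) ((hPw.weight s).nonneg n)
                _ ≤ κ * Real.exp U := by linarith [hdom s hs n hn]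
                _ ≤ _ := hx s hs
          linarith
        have h2 := mul_le_mul_of_nonneg_left h1 h0.le
        have h3 := hu (t₀ + j) m
        rw [← add_assoc, h3]
        push_cast
        linarith [ih1 m hm]
      · have h1 := le_force_self hPw hG k (u (t₀ + j)) hθ fun s hs =>
          le_softAttn (hPw.weight s) hu2 (hx s hs) hθ hθ1 hθκ
        have h2 : θ * ε ≤ force P w k (u (t₀ + j)) k :=
          (mul_le_mul_of_nonneg_left (by linarith [hcon (t₀ + j) (by omega)]) hθ).trans h1
        have h3 := mul_le_mul_of_nonneg_left h2 h0.le
        rw [← add_assoc, hu (t₀ + j) k]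
        push_cast
        linarith
  obtain ⟨h1, h2⟩ := key M le_rfl
  have hε' : 0 < ε ^ (-(1 / 2) : ℝ) := Real.rpow_pos_of_pos hε _
  -- the target logit is now so large that the deficit is at most `√ε / 2` on `G`
  have h3 : 18 * ε ^ (-(1 / 2) : ℝ) ≤ κ * Real.exp (u (t₀ + M) k) := by
    have := (Real.log_le_iff_le_exp (by positivity)).1 (hM.trans h2)
    rw [div_mul_eq_mul_div, div_le_iff₀ hκ] at this
    linarith
  have h4 := colLoss_le hPw hG k (u (t₀ + M)) (r := 9 / (18 * ε ^ (-(1 / 2) : ℝ))) fun s hs =>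
    one_sub_softAttn_le (hPw.weight s) (fun m hm => by linarith [h1 m hm]) (by positivity)
      (h3.trans (mul_le_mul_of_nonneg_right (hκG s hs) (Real.exp_pos _).le))
  have h5 : (9 / (18 * ε ^ (-(1 / 2) : ℝ))) ^ 2 = ε / 4 := by
    have : (ε ^ (-(1 / 2) : ℝ)) ^ 2 = ε⁻¹ := by
      rw [← Real.rpow_natCast, ← Real.rpow_mul hε.le, ← Real.rpow_neg_one]
      norm_num
    rw [div_pow, mul_pow, this]
    field_simp
    norm_num
  have := hcon (t₀ + M) le_rfl
  rw [h5] at h4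
  linarith

/-- On weights that agree up to a factor `3`, the attention deficits agree up to a factor `9`. -/
lemma one_sub_softAttn_le_nine_mul {w w' : ι → ℝ} (hw : IsDistribution w) (hw' : IsDistribution w')
    (h : ∀ n, w n ≤ 3 * w' n) (h' : ∀ n, w' n ≤ 3 * w n) (u : ι → ℝ) (k : ι) :
    1 - softAttn w u k ≤ 9 * (1 - softAttn w' u k) := by
  have key : ∀ (x y : ι → ℝ) (S : Finset ι), (∀ n, x n ≤ 3 * y n) →
      ∑ m ∈ S, x m * Real.exp (u m) ≤ 3 * ∑ m ∈ S, y m * Real.exp (u m) := by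
    intro x y S hxy
    rw [Finset.mul_sum]
    refine Finset.sum_le_sum fun m _ => ?_
    rw [← mul_assoc]
    exact mul_le_mul_of_nonneg_right (hxy m) (Real.exp_pos _).le
  rw [one_sub_softAttn hw, one_sub_softAttn hw', div_le_iff₀ (hw.partition_pos u)]
  have h1 := key w w' (Finset.univ.erase k) h
  have h2 := key w' w Finset.univ h'
  have hZ := hw'.partition_pos u
  have hR := rest_nonneg hw' u k
  refine h1.trans ?_
  rw [← mul_div_assoc, div_mul_eq_mul_div, le_div_iff₀ hZ]
  nlinarith

/-- If the weights agree up to a factor `3` on an event, the loss bounds the attention deficit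
throughout this event. -/
lemma sq_one_sub_softAttn_le {P : Ω → ℝ} {w : Ω → ι → ℝ} {G : Finset Ω} {δ : ℝ}
    (hPw : IsRandomWeights P w) (hG : 1 - δ ≤ ∑ s ∈ G, P s) (hδ : δ ≤ 1 / 2)
    (h : ∀ s ∈ G, ∀ s' ∈ G, ∀ n, w s n ≤ 3 * w s' n) (k : ι) (u : ι → ℝ) {s : Ω} (hs : s ∈ G) :
    (1 - softAttn (w s) u k) ^ 2 ≤ 324 * colLoss P w k u := by
  have h1 : ∀ s' ∈ G, (1 - softAttn (w s) u k) ^ 2 / 81 ≤ sqDist k (softAttn (w s') u) := by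
    intro s' hs'
    have h2 := one_sub_softAttn_le_nine_mul (hPw.weight s) (hPw.weight s') (h s hs s' hs')
      (h s' hs' s hs) u k
    have h3 := (hPw.attn u s).le_one k
    have h4 := sq_one_sub_le_sqDist k (softAttn (w s') u)
    nlinarith
  have h2 := const_le_expectation_restrict hPw.prob hG (by positivity) h1
  have h3 : ∑ s ∈ G, P s * sqDist k (softAttn (w s) u) ≤ ∑ s, P s * sqDist k (softAttn (w s) u) :=
    expectation_restrict_le hPw.prob fun s => sqDist_nonneg k _
  have h4 : 0 ≤ (1 - softAttn (w s) u k) ^ 2 := sq_nonneg _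
  rw [colLoss]
  nlinarith

end randomWeights

/-! ### The early phase of an under-represented feature -/

section early

variable {ι Ω : Type*} [Fintype ι] [Fintype Ω] [DecidableEq ι]

/-- Attention scores `A` before the target `k` takes over: the dominant feature `D` has score at
most of order `exp uD`, the other features have scores of order at most `r`, the target has score
of order at least `r`, and a fixed proportion of the attention is neither on `k` nor on `D`. -/
structure IsSpread (c C r : ℝ) (k D : ι) (uD : ℝ) (A : ι → ℝ) : Prop where
  isDistribution : IsDistribution A
  other_le : ∀ m, m ≠ k → m ≠ D → A m ≤ C * r
  le_target : c * r ≤ A k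
  add_le : A k + A D ≤ 1 - c
  dominant_le : A D ≤ C * Real.exp uD

lemma sum_eq_add_add {D k : ι} (hD : D ≠ k) (f : ι → ℝ) :
    ∑ m, f m = f k + (f D + ∑ m ∈ (Finset.univ.erase k).erase D, f m) := by
  rw [Finset.add_sum_erase _ _ (Finset.mem_erase.2 ⟨hD, Finset.mem_univ D⟩),
    Finset.add_sum_erase _ _ (Finset.mem_univ k)]

lemma isSpread_softAttn {w u : ι → ℝ} {k D : ι} {α β ρ r : ℝ} (hw : IsDistribution w)
    (hD : D ≠ k) (hα : 0 < α) (hβ : 0 < β) (hr : 0 < r) (hρ : 0 < ρ)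
    (hwk : α * r ≤ w k) (hwk' : w k ≤ β * r) (hwo : ∀ m, m ≠ k → m ≠ D → w m ≤ β * r)
    (hmass : α / 2 ≤ ∑ m ∈ (Finset.univ.erase k).erase D, w m)
    (hu : ∀ m, m ≠ k → m ≠ D → |u m| ≤ 1) (huD : u D ≤ 1) (huk : 0 ≤ u k)
    (huk' : Real.exp (u k) * r ≤ ρ) :
    IsSpread (α / (6 * (3 + β * ρ))) ((18 * β + 6) / α) r k D (u D) (softAttn w u) := by
  have hA := isDistribution_softAttn hw u
  set S := ∑ m ∈ (Finset.univ.erase k).erase D, w m * Real.exp (u m) with hS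
  set Z := ∑ m, w m * Real.exp (u m) with hZ
  have hZS : Z = w k * Real.exp (u k) + (w D * Real.exp (u D) + S) := sum_eq_add_add hD _
  have hZ0 : 0 < Z := hw.partition_pos u
  have hmem : ∀ m ∈ (Finset.univ.erase k).erase D, m ≠ k ∧ m ≠ D := fun m hm =>
    ⟨Finset.ne_of_mem_erase (Finset.mem_of_mem_erase hm), Finset.ne_of_mem_erase hm⟩
  have hS1 : α / 6 ≤ S := by
    have : (∑ m ∈ (Finset.univ.erase k).erase D, w m) * (1 / 3) ≤ S := by
      rw [Finset.sum_mul]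
      refine Finset.sum_le_sum fun m hm => mul_le_mul_of_nonneg_left ?_ (hw.nonneg m)
      have h1 := (abs_le.1 (hu m (hmem m hm).1 (hmem m hm).2)).1
      calc (1 / 3 : ℝ) ≤ (Real.exp 1)⁻¹ := by
            rw [one_div]; exact inv_anti₀ (Real.exp_pos _) exp_one_lt_three.le
        _ = Real.exp (-1) := (Real.exp_neg 1).symm
        _ ≤ _ := Real.exp_le_exp.2 h1
    linarith
  have hkpos : 0 ≤ w k * Real.exp (u k) := mul_nonneg (hw.nonneg k) (Real.exp_pos _).le
  have hDpos : 0 ≤ w D * Real.exp (u D) := mul_nonneg (hw.nonneg D) (Real.exp_pos _).le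
  have hZ1 : α / 6 ≤ Z := by linarith
  have hZ2 : Z ≤ 3 + β * ρ := by
    have h1 : w k * Real.exp (u k) ≤ β * ρ := by
      calc w k * Real.exp (u k) ≤ β * r * Real.exp (u k) :=
            mul_le_mul_of_nonneg_right hwk' (Real.exp_pos _).le
        _ = β * (Real.exp (u k) * r) := by ring
        _ ≤ β * ρ := mul_le_mul_of_nonneg_left huk' hβ.le
    have h2 : ∑ m ∈ Finset.univ.erase k, w m * Real.exp (u m) ≤ 3 := by
      refine hw.sum_mul_le _ (by norm_num) fun m hm => ?_
      refine (Real.exp_le_exp.2 ?_).trans exp_one_lt_three.le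
      by_cases h : m = D
      · rw [h]; exact huD
      · exact (abs_le.1 (hu m (Finset.ne_of_mem_erase hm) h)).2
    rw [partition_eq w u k] at hZ
    linarith
  have hZm : 0 < 3 + β * ρ := by positivity
  refine ⟨hA, fun m hm hmD => ?_, ?_, ?_, ?_⟩
  · rw [softAttn, div_le_iff₀ hZ0]
    have h1 : w m * Real.exp (u m) ≤ β * r * 3 :=
      mul_le_mul (hwo m hm hmD) ((Real.exp_le_exp.2 (abs_le.1 (hu m hm hmD)).2).trans
        exp_one_lt_three.le) (Real.exp_pos _).le (by positivity)
    have h2 : (18 * β + 6) / α * r * (α / 6) ≤ (18 * β + 6) / α * r * Z :=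
      mul_le_mul_of_nonneg_left hZ1 (by positivity)
    have h3 : (18 * β + 6) / α * r * (α / 6) = β * r * 3 + r := by field_simp; ring
    linarith
  · rw [softAttn, le_div_iff₀ hZ0]
    have h1 : α * r * 1 ≤ w k * Real.exp (u k) :=
      mul_le_mul hwk (Real.one_le_exp huk) zero_le_one (hw.nonneg k)
    have h2 : α / (6 * (3 + β * ρ)) * r * Z ≤ α / (6 * (3 + β * ρ)) * r * (3 + β * ρ) :=
      mul_le_mul_of_nonneg_left hZ2 (by positivity)
    have h3 : α / (6 * (3 + β * ρ)) * r * (3 + β * ρ) = α * r / 6 := by field_simp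
    have h4 : 0 < α * r := by positivity
    linarith
  · have h1 : softAttn w u k + softAttn w u D = 1 - S / Z := by
      rw [softAttn, softAttn, ← hZ]
      field_simp
      linarith
    have h2 : α / (6 * (3 + β * ρ)) ≤ S / Z := by
      rw [← div_div]
      exact div_le_div₀ (by linarith) hS1 hZ0 hZ2
    linarith
  · rw [softAttn, div_le_iff₀ hZ0]
    have h1 : w D * Real.exp (u D) ≤ Real.exp (u D) :=
      mul_le_of_le_one_left (Real.exp_pos _).le (hw.le_one D)
    have h2 : (18 * β + 6) / α * Real.exp (u D) * (α / 6)
        ≤ (18 * β + 6) / α * Real.exp (u D) * Z :=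
      mul_le_mul_of_nonneg_left hZ1 (by positivity)
    have h3 : (18 * β + 6) / α * Real.exp (u D) * (α / 6)
        = (3 * β + 1) * Real.exp (u D) := by field_simp; ring
    have h4 : 0 < β * Real.exp (u D) := by positivity
    linarith

namespace IsSpread

variable {c C r uD : ℝ} {k D : ι} {A : ι → ℝ} (h : IsSpread c C r k D uD A)
include h

lemma sum_sq_le (hD : D ≠ k) (hCr : 0 ≤ C * r) :
    ∑ m, A m ^ 2 ≤ A k ^ 2 + A D ^ 2 + C * r := by
  rw [sum_eq_add_add hD]
  have h1 : ∑ m ∈ (Finset.univ.erase k).erase D, A m ^ 2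
      ≤ C * r * ∑ m ∈ (Finset.univ.erase k).erase D, A m :=
    sum_sq_le_mul_sum h.isDistribution _ fun m hm =>
      h.other_le m (Finset.ne_of_mem_erase (Finset.mem_of_mem_erase hm))
        (Finset.ne_of_mem_erase hm)
  have h2 := sum_eq_add_add hD A
  rw [h.isDistribution.sum_eq_one] at h2
  have h3 : ∑ m ∈ (Finset.univ.erase k).erase D, A m ≤ 1 := by
    linarith [h.isDistribution.nonneg k, h.isDistribution.nonneg D]
  nlinarith

lemma pull_dominant_le (hD : D ≠ k) (hc : 0 < c) (hCr : 0 ≤ C * r) :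
    pull k A D ≤ -(c / 2) * A D ^ 2 + C ^ 2 * r ^ 2 / (2 * c) := by
  rw [pull_of_ne hD]
  have h1 := h.sum_sq_le hD hCr
  have hk := h.isDistribution.nonneg k
  have hD0 := h.isDistribution.nonneg D
  have h2 : ∑ m, A m ^ 2 - A k - A D ≤ C * r - c * A D := by
    nlinarith [h.add_le, mul_nonneg hk hD0]
  have h3 : A D * (∑ m, A m ^ 2 - A k - A D) ≤ A D * (C * r - c * A D) :=
    mul_le_mul_of_nonneg_left h2 hD0
  have h4 : -(c / 2) * A D ^ 2 + C ^ 2 * r ^ 2 / (2 * c) - A D * (C * r - c * A D)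
      = (c * A D - C * r) ^ 2 / (2 * c) := by field_simp; ring
  have h5 : 0 ≤ (c * A D - C * r) ^ 2 / (2 * c) := by positivity
  linarith

lemma abs_pull_other_le (hD : D ≠ k) (hCr : 0 ≤ C * r) {m : ι} (hm : m ≠ k) (hmD : m ≠ D) :
    |pull k A m| ≤ C * r * (A D ^ 2 + A k + 2 * (C * r)) := by
  rw [pull_of_ne hm, abs_mul, abs_of_nonneg (h.isDistribution.nonneg m)]
  have h1 := h.sum_sq_le hD hCr
  have h0 : 0 ≤ ∑ m, A m ^ 2 := Finset.sum_nonneg fun m _ => sq_nonneg _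
  have hk := h.isDistribution.nonneg k
  have hk1 := h.isDistribution.le_one k
  have hm0 := h.isDistribution.nonneg m
  have hm1 := h.other_le m hm hmD
  refine mul_le_mul hm1 ?_ (abs_nonneg _) hCr
  rw [abs_le]
  constructor <;> nlinarith [sq_nonneg (A D)]

lemma le_pull_target (hc : 0 < c) : c ^ 2 * A k ≤ pull k A k := by
  rw [pull_self, mul_comm]
  have h1 := sq_one_sub_le_sqDist k A
  have h2 : c ≤ 1 - A k := by linarith [h.add_le, h.isDistribution.nonneg D]
  refine mul_le_mul_of_nonneg_left ?_ (h.isDistribution.nonneg k)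
  nlinarith

end IsSpread

/-- The components of the force in the early phase, compared with its component `X` towards the
target; `Y` is the second moment of the attention score of the dominant feature. -/
structure EarlyForce (q B r : ℝ) (k D : ι) (uD : ℝ) (F : ι → ℝ) (Y : ℝ) : Prop where
  nonneg : 0 ≤ Y
  le_exp : Y ≤ B * Real.exp uD ^ 2
  target : q * r ≤ F k
  dominant : F D ≤ -q * Y + B * r * F k
  other : ∀ m, m ≠ k → m ≠ D → |F m| ≤ B * r * (F k + Y)

/-- On spread attention scores, both `δ` and `r ^ 2` are of order at most `r` times the force on the
target, so that all error terms are absorbed by it. -/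
lemma exists_earlyForce {P : Ω → ℝ} {w : Ω → ι → ℝ} {G : Finset Ω} {k D : ι} {u : ι → ℝ}
    {δ c C r : ℝ} (hPw : IsRandomWeights P w) (hG : 1 - δ ≤ ∑ s ∈ G, P s) (hD : D ≠ k)
    (hc : 0 < c) (hc1 : c ≤ 1) (hC : 0 < C) (hr : 0 < r) (hδr : δ ≤ r ^ 2) (hδ : δ ≤ 1 / 2)
    (h : ∀ s ∈ G, IsSpread c C r k D (u D) (softAttn (w s) u)) :
    ∃ Y, EarlyForce (c ^ 3 / 2) (C + C / c ^ 2 + 4 * C ^ 2 / c ^ 3 + 2 / c ^ 3 + C ^ 2 / c ^ 4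
      + C ^ 2) r k D (u D) (force P w k u) Y := by
  set X := force P w k u k with hX
  set Y := ∑ s ∈ G, P s * softAttn (w s) u D ^ 2 with hY
  set E := ∑ s ∈ G, P s * softAttn (w s) u k with hE
  have hY0 : 0 ≤ Y := Finset.sum_nonneg fun s _ => mul_nonneg (hPw.prob.nonneg s) (sq_nonneg _)
  have hCr : 0 ≤ C * r := by positivity
  have hXE : c ^ 2 * E ≤ X := by
    have h1 : c ^ 2 * E ≤ ∑ s ∈ G, P s * pull k (softAttn (w s) u) k := by
      rw [hE, Finset.mul_sum]
      refine Finset.sum_le_sum fun s hs => ?_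
      rw [mul_left_comm]
      exact mul_le_mul_of_nonneg_left ((h s hs).le_pull_target hc) (hPw.prob.nonneg s)
    exact h1.trans (expectation_restrict_le hPw.prob fun s => pull_self_nonneg (hPw.attn u s) k)
  have hEr : c * r / 2 ≤ E := by
    have h1 := const_le_expectation_restrict hPw.prob hG (by positivity : 0 ≤ c * r)
      fun s hs => (h s hs).le_target
    have h2 : 0 < c * r := by positivity
    nlinarith
  have hXr : c ^ 3 / 2 * r ≤ X := by
    refine le_trans ?_ hXE
    calc c ^ 3 / 2 * r = c ^ 2 * (c * r / 2) := by ring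
      _ ≤ c ^ 2 * E := mul_le_mul_of_nonneg_left hEr (by positivity)
  have hX0 : 0 ≤ X := le_trans (by positivity) hXr
  have hEX : E ≤ X / c ^ 2 := by rw [le_div_iff₀ (by positivity)]; linarith
  have hrX : r ≤ 2 / c ^ 3 * X := by
    rw [div_mul_eq_mul_div, le_div_iff₀ (by positivity)]; linarith
  have hr2X : r ^ 2 ≤ r * (2 / c ^ 3 * X) := by
    rw [sq]; exact mul_le_mul_of_nonneg_left hrX hr.le
  have ha : 0 ≤ C / c ^ 2 := by positivity
  have hb : 0 ≤ C ^ 2 / c ^ 3 := by positivity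
  have hd : 0 ≤ 1 / c ^ 3 := by positivity
  have he : 0 ≤ C ^ 2 / c ^ 4 := by positivity
  have hf : 0 ≤ C ^ 2 := by positivity
  have hle : ∀ x y : ℝ, 0 ≤ y → x ≤ C + C / c ^ 2 + 4 * C ^ 2 / c ^ 3 + 2 / c ^ 3 + C ^ 2 / c ^ 4
      + C ^ 2 → x * y ≤ (C + C / c ^ 2 + 4 * C ^ 2 / c ^ 3 + 2 / c ^ 3 + C ^ 2 / c ^ 4
      + C ^ 2) * y := fun x y hy hx => mul_le_mul_of_nonneg_right hx hy
  have hBb : 4 * C ^ 2 / c ^ 3 = 4 * (C ^ 2 / c ^ 3) := by ring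
  have hBd : 2 / c ^ 3 = 2 * (1 / c ^ 3) := by ring
  refine ⟨Y, hY0, ?_, hXr, ?_, fun m hm hmD => ?_⟩
  · have h1 : Y ≤ C ^ 2 * Real.exp (u D) ^ 2 := by
      refine expectation_restrict_le_const hPw.prob (by positivity) fun s hs => ?_
      rw [← mul_pow]
      exact pow_le_pow_left₀ ((hPw.attn u s).nonneg D) (h s hs).dominant_le 2
    exact h1.trans (hle _ _ (by positivity) (by linarith))
  · have h1 : ∑ s ∈ G, P s * pull k (softAttn (w s) u) D
        ≤ -(c / 2) * Y + C ^ 2 * r ^ 2 / (2 * c) := by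
      have h2 : ∑ s ∈ G, P s * (pull k (softAttn (w s) u) D + c / 2 * softAttn (w s) u D ^ 2)
          ≤ C ^ 2 * r ^ 2 / (2 * c) :=
        expectation_restrict_le_const hPw.prob (by positivity) fun s hs => by
          linarith [(h s hs).pull_dominant_le hD hc hCr]
      have h3 : ∑ s ∈ G, P s * (pull k (softAttn (w s) u) D + c / 2 * softAttn (w s) u D ^ 2)
          = ∑ s ∈ G, P s * pull k (softAttn (w s) u) D + c / 2 * Y := by
        rw [hY, Finset.mul_sum, ← Finset.sum_add_distrib]
        exact Finset.sum_congr rfl fun s _ => by ring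
      linarith
    have h2 := force_le hPw hG hD u
    have h3 : C ^ 2 * r ^ 2 / (2 * c) ≤ C ^ 2 / c ^ 4 * (r * X) := by
      calc C ^ 2 * r ^ 2 / (2 * c) = C ^ 2 / (2 * c) * r ^ 2 := by ring
        _ ≤ C ^ 2 / (2 * c) * (r * (2 / c ^ 3 * X)) :=
          mul_le_mul_of_nonneg_left hr2X (by positivity)
        _ = C ^ 2 / c ^ 4 * (r * X) := by field_simp
    have h4 : δ ≤ 2 / c ^ 3 * (r * X) := by linarith
    have h5 : c ^ 3 / 2 * Y ≤ c / 2 * Y := by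
      refine mul_le_mul_of_nonneg_right ?_ hY0
      have : c ^ 3 ≤ c := by
        calc c ^ 3 = c * c ^ 2 := by ring
          _ ≤ c * 1 := mul_le_mul_of_nonneg_left (pow_le_one₀ hc.le hc1) hc.le
          _ = c := mul_one c
      linarith
    have h6 := hle (C ^ 2 / c ^ 4 + 2 / c ^ 3) (r * X) (by positivity) (by linarith)
    linarith
  · have h1 := abs_force_le hPw hG hm u
    have h2 : ∑ s ∈ G, P s * |pull k (softAttn (w s) u) m|
        ≤ C * r * (Y + E + 2 * (C * r)) := by
      have h3 : ∑ s ∈ G, P s * (C * r * (softAttn (w s) u D ^ 2 + softAttn (w s) u k))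
          = C * r * (Y + E) := by
        rw [hY, hE, ← Finset.sum_add_distrib, Finset.mul_sum]
        exact Finset.sum_congr rfl fun s _ => by ring
      have h4 : ∑ s ∈ G, P s * (|pull k (softAttn (w s) u) m|
          - C * r * (softAttn (w s) u D ^ 2 + softAttn (w s) u k)) ≤ C * r * (2 * (C * r)) :=
        expectation_restrict_le_const hPw.prob (by positivity) fun s hs => by
          linarith [(h s hs).abs_pull_other_le hD hCr hm hmD]
      simp only [mul_sub (P _), Finset.sum_sub_distrib] at h4
      linarith
    have h3 : C * r * (Y + E + 2 * (C * r))
        ≤ C * (r * Y) + (C / c ^ 2 + 4 * C ^ 2 / c ^ 3) * (r * X) := by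
      have h4 : C * r * E ≤ C / c ^ 2 * (r * X) := by
        calc C * r * E ≤ C * r * (X / c ^ 2) := mul_le_mul_of_nonneg_left hEX hCr
          _ = _ := by ring
      have h5 : C * r * (2 * (C * r)) ≤ 4 * C ^ 2 / c ^ 3 * (r * X) := by
        calc C * r * (2 * (C * r)) = 2 * C ^ 2 * r ^ 2 := by ring
          _ ≤ 2 * C ^ 2 * (r * (2 / c ^ 3 * X)) :=
            mul_le_mul_of_nonneg_left hr2X (by positivity)
          _ = _ := by ring
      linarith
    have h4 : δ ≤ 2 / c ^ 3 * (r * X) := by linarith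
    have h5 := hle C (r * Y) (by positivity) (by linarith)
    have h6 := hle (C / c ^ 2 + 4 * C ^ 2 / c ^ 3 + 2 / c ^ 3) (r * X) (by positivity) (by linarith)
    linarith

omit [Fintype ι] in
/-- Deterministic dynamics of the early phase. The logits of the other features stay bounded
because their drift is controlled by the growth of the target logit and by the decrease of
the logit of the dominant feature, cut off at the level `log r` below which this feature no longer
matters. -/
lemma exists_early_exit {u F : ℕ → ι → ℝ} {k D : ι} {q B r h U : ℝ} (hD : D ≠ k)
    (hu0 : u 0 = 0) (hu : ∀ t n, u (t + 1) n = u t n + h * F t n)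
    (hq : 0 < q) (hB : 0 < B) (hr : 0 < r) (hr1 : r ≤ 1) (hh : 0 < h) (hh1 : h ≤ 1 / 2)
    (hU : 0 ≤ U) (hF2 : ∀ t, F t k ≤ 2) (hF1 : ∀ t n, n ≠ k → |F t n| ≤ 1)
    (hF : ∀ t, (∀ m, m ≠ k → m ≠ D → |u t m| ≤ 1) → u t D ≤ 1 → 0 ≤ u t k → u t k ≤ U →
      ∃ Y, EarlyForce q B r k D (u t D) (F t) Y)
    (hsmall : B * r / q * ((q + 10 * B) * (U + 1) - Real.log r) ≤ 1) :
    ∃ t : ℕ, (t : ℝ) ≤ U / (h * (q * r)) + 1 ∧ U ≤ u t k ∧ ∀ m, m ≠ k → u t m ≤ 1 := by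
  have hlog : Real.log r ≤ 0 := Real.log_nonpos hr.le hr1
  have hBrq : 0 < B * r / q := by positivity
  have hBq : B * r * (U + 1) ≤ 1 := by
    refine le_trans ?_ hsmall
    have h1 : B * r * (U + 1) = B * r / q * (q * (U + 1)) := by field_simp
    rw [h1]
    refine mul_le_mul_of_nonneg_left ?_ hBrq.le
    nlinarith [mul_nonneg hB.le (by linarith : 0 ≤ U + 1)]
  -- the bounds that the invariant provides as long as `u t k ≤ U + 1`
  have region : ∀ t, (∀ m, m ≠ k → m ≠ D →
        |u t m| ≤ B * r / q * ((q + 10 * B) * u t k - max (u t D) (Real.log r))) →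
      u t D ≤ B * r * u t k → u t k ≤ U + 1 →
      (∀ m, m ≠ k → m ≠ D → |u t m| ≤ 1) ∧ u t D ≤ 1 := by
    intro t h1 h2 h3
    refine ⟨fun m hm hmD => (h1 m hm hmD).trans (le_trans ?_ hsmall), ?_⟩
    · refine mul_le_mul_of_nonneg_left ?_ hBrq.le
      have h4 := mul_le_mul_of_nonneg_left h3 (by positivity : 0 ≤ q + 10 * B)
      linarith [le_max_right (u t D) (Real.log r)]
    · exact h2.trans (le_trans (mul_le_mul_of_nonneg_left h3 (by positivity)) hBq)
  have inv : ∀ t : ℕ, (∀ s < t, u s k < U) →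
      (∀ m, m ≠ k → m ≠ D →
        |u t m| ≤ B * r / q * ((q + 10 * B) * u t k - max (u t D) (Real.log r))) ∧
      u t D ≤ B * r * u t k ∧ t * (h * (q * r)) ≤ u t k ∧ u t k ≤ U + 1 := by
    intro t
    induction t with
    | zero =>
      intro _
      simp only [hu0, Pi.zero_apply, max_eq_left hlog]
      simp
      linarith
    | succ t ih =>
      intro hs
      obtain ⟨i1, i2, i3, i4⟩ := ih fun s hst => hs s (by omega)
      have htU : u t k < U := hs t (by omega)
      have hk0 : 0 ≤ u t k := le_trans (by positivity) i3
      obtain ⟨hO, hD1⟩ := region t i1 i2 i4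
      obtain ⟨Y, hY⟩ := hF t hO hD1 hk0 htU.le
      have hstep : h * (q * r) ≤ h * F t k := mul_le_mul_of_nonneg_left hY.target hh.le
      have hX0 : 0 ≤ h * F t k := le_trans (by positivity) hstep
      have hBrX : 0 ≤ B * r * (h * F t k) := by positivity
      have hYh : 0 ≤ q * (h * Y) := mul_nonneg hq.le (mul_nonneg hh.le hY.nonneg)
      have hDstep : h * F t D ≤ -(q * (h * Y)) + B * r * (h * F t k) := by
        have := mul_le_mul_of_nonneg_left hY.dominant hh.le
        linarith
      have hΦ : q * (h * Y) + (max (u (t + 1) D) (Real.log r) - max (u t D) (Real.log r))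
          ≤ 10 * B * (h * F t k) := by
        have hBr : B * r * (h * F t k) ≤ B * (h * F t k) := by
          refine mul_le_mul_of_nonneg_right ?_ hX0
          exact mul_le_of_le_one_right hB.le hr1
        have hBX : 0 ≤ B * (h * F t k) := by positivity
        rw [hu t D]
        -- above the cut-off, a step stays above `log r` and pays for `Y`; below it, `Y` is negligible
        rcases le_total (Real.log r + 1) (u t D) with hcase | hcase
        · have h1 : -1 ≤ h * F t D := by
            have := (abs_le.1 (hF1 t D hD)).1
            nlinarith
          rw [max_eq_left (by linarith : Real.log r ≤ u t D),
            max_eq_left (by linarith : Real.log r ≤ u t D + h * F t D)]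
          linarith
        · have h1 : max (u t D + h * F t D) (Real.log r)
              ≤ max (u t D) (Real.log r) + B * r * (h * F t k) :=
            max_le (by linarith [le_max_left (u t D) (Real.log r)])
              (by linarith [le_max_right (u t D) (Real.log r)])
          have h2 : Real.exp (u t D) ^ 2 ≤ 9 * r ^ 2 := by
            have : Real.exp (u t D) ≤ 3 * r := by
              refine (Real.exp_le_exp.2 hcase).trans ?_
              rw [Real.exp_add, Real.exp_log hr]
              nlinarith [exp_one_lt_three]
            nlinarith [Real.exp_pos (u t D)]
          have h3 : Y ≤ B * (9 * r ^ 2) :=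
            hY.le_exp.trans (mul_le_mul_of_nonneg_left h2 hB.le)
          have h4 : q * (h * Y) ≤ 9 * B * r * (h * (q * r)) := by
            have := mul_le_mul_of_nonneg_left h3 (by positivity : 0 ≤ q * h)
            linarith
          have h5 : 9 * B * r * (h * (q * r)) ≤ 9 * B * r * (h * F t k) :=
            mul_le_mul_of_nonneg_left hstep (by positivity)
          linarith
      refine ⟨fun m hm hmD => ?_, ?_, ?_, ?_⟩
      · have h1 : h * |F t m| ≤ B * r / q * (q * (h * F t k) + q * (h * Y)) := by
          have h2 := mul_le_mul_of_nonneg_left (hY.other m hm hmD) hh.le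
          have h3 : B * r / q * (q * (h * F t k) + q * (h * Y))
              = h * (B * r * (F t k + Y)) := by field_simp
          rw [h3]; exact h2
        have h2 : |u (t + 1) m| ≤ |u t m| + h * |F t m| := by
          rw [hu t m]
          refine (abs_add_le _ _).trans ?_
          rw [abs_mul, abs_of_pos hh]
        have h3 := mul_le_mul_of_nonneg_left hΦ hBrq.le
        have h4 := i1 m hm hmD
        have h5 := hu t k
        rw [h5]
        linarith
      · have h5 := hu t k
        have h6 := hu t D
        rw [h5, h6]
        linarith
      · rw [hu t k]
        push_cast
        linarith
      · rw [hu t k]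
        nlinarith [hF2 t]
  have hpos : 0 < h * (q * r) := by positivity
  have hex : ∃ t, U ≤ u t k := by
    by_contra! hcon
    obtain ⟨t, ht⟩ := exists_nat_gt (U / (h * (q * r)))
    have h1 := (inv t fun s _ => hcon s).2.2.1
    rw [div_lt_iff₀ hpos] at ht
    linarith [hcon t]
  classical
  have hmin : ∀ s < Nat.find hex, u s k < U := fun s hs => not_le.1 (Nat.find_min hex hs)
  obtain ⟨i1, i2, -, i4⟩ := inv _ hmin
  obtain ⟨hO, hD1⟩ := region _ i1 i2 i4
  refine ⟨Nat.find hex, ?_, Nat.find_spec hex, fun m hm => ?_⟩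
  · rcases Nat.eq_zero_or_pos (Nat.find hex) with h0 | h0
    · rw [h0]
      simp only [Nat.cast_zero]
      positivity
    · obtain ⟨t, ht⟩ : ∃ t, Nat.find hex = t + 1 := ⟨Nat.find hex - 1, by omega⟩
      have h1 := (inv t fun s hs => hmin s (by omega)).2.2.1
      have h2 := hmin t (by omega)
      rw [ht]
      push_cast
      have : (t : ℝ) ≤ U / (h * (q * r)) := by rw [le_div_iff₀ hpos]; linarith
      linarith
  · by_cases hmD : m = D
    · rw [hmD]; exact hD1
    · exact (abs_le.1 (hO m hm hmD)).2

end early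

/-! ### Concentration of the token frequencies -/

section concentration

variable {K N : ℕ} {p : Fin K → ℝ}

lemma sum_seqProb_mul_prod (p f : Fin K → ℝ) :
    ∑ s : Fin N → Fin K, seqProb p s * ∏ i, f (s i) = (∑ k, p k * f k) ^ N := by
  rw [Fintype.sum_pow]
  exact Finset.sum_congr rfl fun s _ => by rw [seqProb, Finset.prod_mul_distrib]

lemma isDistribution_seqProb (hp : IsDistribution p) :
    IsDistribution (seqProb p : (Fin N → Fin K) → ℝ) where
  nonneg s := Finset.prod_nonneg fun i _ => hp.nonneg _
  sum_eq_one := by simpa [hp.sum_eq_one] using sum_seqProb_mul_prod (N := N) p fun _ => 1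

lemma isRandomWeights_freq (hp : IsDistribution p) (hN : 0 < N) :
    IsRandomWeights (seqProb p) (freq : (Fin N → Fin K) → Fin K → ℝ) where
  prob := isDistribution_seqProb hp
  weight s := ⟨freq_nonneg s, sum_freq hN s⟩

/-- An exponential tail bound for sums of independent bounded centred variables. -/
lemma seqProb_tail (hp : IsDistribution p) {X : Fin K → ℝ} (hX : ∀ k, |X k| ≤ 1)
    (hX0 : ∑ k, p k * X k = 0) {τ : ℝ} (hτ : 0 ≤ τ) (hτ1 : τ ≤ 1) :
    ∑ s : Fin N → Fin K with N * τ ≤ ∑ i, X (s i), seqProb p s ≤ Real.exp (-(N * τ ^ 2 / 4)) := by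
  have h1 : ∑ s : Fin N → Fin K with N * τ ≤ ∑ i, X (s i), seqProb p s
      ≤ Real.exp (-(τ / 2 * (N * τ))) *
        ∑ s : Fin N → Fin K, seqProb p s * ∏ i, Real.exp (τ / 2 * X (s i)) := by
    rw [Finset.sum_filter, Finset.mul_sum]
    refine Finset.sum_le_sum fun s _ => ?_
    have hs := (isDistribution_seqProb hp).nonneg s
    rw [← Real.exp_sum, ← Finset.mul_sum, mul_left_comm, ← Real.exp_add]
    split_ifs with h
    · refine le_mul_of_one_le_right hs (Real.one_le_exp ?_)
      nlinarith
    · exact mul_nonneg hs (Real.exp_pos _).le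
  have h2 : ∑ k, p k * Real.exp (τ / 2 * X k) ≤ Real.exp ((τ / 2) ^ 2) := by
    have h3 : ∀ k, Real.exp (τ / 2 * X k) ≤ 1 + τ / 2 * X k + (τ / 2) ^ 2 := by
      intro k
      have h4 : |τ / 2 * X k| ≤ 1 := by
        rw [abs_mul, abs_of_nonneg (by linarith : 0 ≤ τ / 2)]
        nlinarith [hX k, abs_nonneg (X k)]
      have h5 := (abs_le.1 (Real.abs_exp_sub_one_sub_id_le h4)).2
      have h6 : X k ^ 2 ≤ 1 := (sq_le_one_iff_abs_le_one _).2 (hX k)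
      nlinarith [sq_nonneg τ]
    calc ∑ k, p k * Real.exp (τ / 2 * X k)
        ≤ ∑ k, p k * (1 + τ / 2 * X k + (τ / 2) ^ 2) :=
          Finset.sum_le_sum fun k _ => mul_le_mul_of_nonneg_left (h3 k) (hp.nonneg k)
      _ = (∑ k, p k) * (1 + (τ / 2) ^ 2) + τ / 2 * ∑ k, p k * X k := by
          rw [Finset.sum_mul, Finset.mul_sum, ← Finset.sum_add_distrib]
          exact Finset.sum_congr rfl fun k _ => by ring
      _ = (τ / 2) ^ 2 + 1 := by rw [hp.sum_eq_one, hX0]; ring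
      _ ≤ _ := Real.add_one_le_exp _
  rw [sum_seqProb_mul_prod p fun k => Real.exp (τ / 2 * X k)] at h1
  refine h1.trans ?_
  have h3 : (∑ k, p k * Real.exp (τ / 2 * X k)) ^ N ≤ Real.exp ((τ / 2) ^ 2) ^ N :=
    pow_le_pow_left₀ (Finset.sum_nonneg fun k _ => mul_nonneg (hp.nonneg k) (Real.exp_pos _).le)
      h2 N
  refine (mul_le_mul_of_nonneg_left h3 (Real.exp_pos _).le).trans (le_of_eq ?_)
  rw [← Real.exp_nat_mul, ← Real.exp_add]
  congr 1
  ring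

lemma sum_indicator_sub (hN : 0 < N) (s : Fin N → Fin K) (n : Fin K) :
    ∑ i, ((if s i = n then 1 else 0) - p n) = N * (freq s n - p n) := by
  have : (N : ℝ) ≠ 0 := by positivity
  rw [Finset.sum_sub_distrib, Finset.sum_boole]
  simp only [Finset.sum_const, Finset.card_univ, Fintype.card_fin, nsmul_eq_mul, freq]
  field_simp

/-- The event that all token frequencies are within `τ` of their expected values. -/
def typical (p : Fin K → ℝ) (N : ℕ) (τ : ℝ) : Finset (Fin N → Fin K) :=
  Finset.univ.filter fun s => ∀ n, |freq s n - p n| ≤ τ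

lemma le_sum_typical (hp : IsDistribution p) (hN : 0 < N) {τ : ℝ} (hτ : 0 ≤ τ) (hτ1 : τ ≤ 1) :
    1 - 2 * K * Real.exp (-(N * τ ^ 2 / 4)) ≤ ∑ s ∈ typical p N τ, seqProb p s := by
  have hnn := (isDistribution_seqProb hp (N := N)).nonneg
  have hsplit := Finset.sum_filter_add_sum_filter_not Finset.univ
    (fun s : Fin N → Fin K => ∀ n, |freq s n - p n| ≤ τ) (seqProb p)
  rw [(isDistribution_seqProb hp).sum_eq_one] at hsplit
  have hX : ∀ n k, |(if k = n then 1 else 0) - p n| ≤ 1 := by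
    intro n k
    have h0 := hp.nonneg n
    have h1 := hp.le_one n
    rw [abs_le]
    split_ifs <;> constructor <;> linarith
  have hX0 : ∀ n, ∑ k, p k * ((if k = n then 1 else 0) - p n) = 0 := by
    intro n
    simp [mul_sub, Finset.sum_sub_distrib, ← Finset.sum_mul, hp.sum_eq_one]
  have hbad : ∑ s : Fin N → Fin K with ¬ ∀ n, |freq s n - p n| ≤ τ, seqProb p s
      ≤ ∑ n, (∑ s : Fin N → Fin K with N * τ ≤ ∑ i, ((if s i = n then 1 else 0) - p n),
          seqProb p s
        + ∑ s : Fin N → Fin K with N * τ ≤ ∑ i, -((if s i = n then 1 else 0) - p n),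
          seqProb p s) := by
    simp only [Finset.sum_filter, ← Finset.sum_add_distrib]
    rw [Finset.sum_comm]
    refine Finset.sum_le_sum fun s _ => ?_
    have hterm : ∀ n ∈ Finset.univ,
        0 ≤ (if N * τ ≤ ∑ i, ((if s i = n then 1 else 0) - p n) then seqProb p s else 0)
          + (if N * τ ≤ ∑ i, -((if s i = n then 1 else 0) - p n) then seqProb p s else 0) := by
      intro n _
      have := hnn s
      split_ifs <;> linarith
    split_ifs with h
    · exact Finset.sum_nonneg hterm
    · push Not at h
      obtain ⟨n, hn⟩ := h
      refine le_trans ?_ (Finset.single_le_sum hterm (Finset.mem_univ n))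
      rw [Finset.sum_neg_distrib, sum_indicator_sub hN]
      have hNr : (0 : ℝ) ≤ N := by positivity
      have hs := hnn s
      rcases lt_abs.1 hn with h1 | h1
      · rw [if_pos (mul_le_mul_of_nonneg_left h1.le hNr)]
        split_ifs <;> linarith
      · rw [if_pos (c := _ ≤ -_) (by nlinarith)]
        split_ifs <;> linarith
  have htail : ∀ n, ∑ s : Fin N → Fin K with N * τ ≤ ∑ i, ((if s i = n then 1 else 0) - p n),
          seqProb p s
        + ∑ s : Fin N → Fin K with N * τ ≤ ∑ i, -((if s i = n then 1 else 0) - p n),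
          seqProb p s ≤ 2 * Real.exp (-(N * τ ^ 2 / 4)) := by
    intro n
    have h1 := seqProb_tail (N := N) hp (hX n) (hX0 n) hτ hτ1
    have h2 := seqProb_tail (N := N) hp (X := fun k => -((if k = n then 1 else 0) - p n))
      (fun k => by rw [abs_neg]; exact hX n k)
      (by simp only [mul_neg, Finset.sum_neg_distrib, hX0 n, neg_zero]) hτ hτ1
    linarith
  have := hbad.trans (Finset.sum_le_sum fun n _ => htail n)
  simp only [Finset.sum_const, Finset.card_univ, Fintype.card_fin, nsmul_eq_mul] at this
  rw [typical]
  linarith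

end concentration

/-! ### The infimum of the loss -/

section infimum

variable {d K N : ℕ} {p : Fin K → ℝ}

lemma freq_eq_zero {s : Fin N → Fin K} {k : Fin K} (h : ∀ i, s i ≠ k) : freq s k = 0 := by
  simp [freq, h]

lemma one_div_le_freq {s : Fin N → Fin K} {k : Fin K} (h : ∃ i, s i = k) :
    1 / (N : ℝ) ≤ freq s k := by
  obtain ⟨i, hi⟩ := h
  refine div_le_div_of_nonneg_right ?_ (Nat.cast_nonneg N)
  exact_mod_cast Finset.card_pos.2 ⟨i, by simp [hi]⟩

/-- The probability that the feature `k` is absent from the prompt. -/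
lemma sum_absent (hp : IsDistribution p) (k : Fin K) :
    ∑ s : Fin N → Fin K, seqProb p s * (if ∀ i, s i ≠ k then 1 else 0) = (1 - p k) ^ N := by
  have h := sum_seqProb_mul_prod (N := N) p fun j => if j ≠ k then 1 else 0
  have h1 : ∑ j, p j * (if j ≠ k then 1 else 0) = 1 - p k := by
    rw [← hp.sum_erase k, ← Finset.filter_ne', Finset.sum_filter]
    exact Finset.sum_congr rfl fun j _ => by simp
  rw [h1] at h
  rw [← h]
  refine Finset.sum_congr rfl fun s _ => ?_
  rw [Finset.prod_boole]
  simp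

lemma le_colLoss (hp : IsDistribution p) (k : Fin K) (u : Fin K → ℝ) :
    1 / 2 * (1 - p k) ^ N ≤ colLoss (seqProb p) (freq (N := N)) k u := by
  rw [← sum_absent hp, colLoss]
  refine mul_le_mul_of_nonneg_left (Finset.sum_le_sum fun s _ =>
    mul_le_mul_of_nonneg_left ?_ ((isDistribution_seqProb hp).nonneg s)) (by norm_num)
  split_ifs with h
  · have := sq_one_sub_le_sqDist k (softAttn (freq s) u)
    simpa [softAttn, freq_eq_zero h] using this
  · exact sqDist_nonneg _ _

/-- A logit `2 * N` of the target suppresses all other features unless the target is absent. -/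
lemma colLoss_le_two_mul_exp (hp : IsDistribution p) (hN : 0 < N) (k : Fin K) :
    colLoss (seqProb p) (freq (N := N)) k (fun n => if n = k then 2 * (N : ℝ) else 0)
      ≤ 2 * Real.exp (-(p k * N)) := by
  set u : Fin K → ℝ := fun n => if n = k then 2 * (N : ℝ) else 0 with hu
  have hPw := isRandomWeights_freq hp hN
  have hNr : (0 : ℝ) < N := by exact_mod_cast hN
  have h1 : ∀ s : Fin N → Fin K, sqDist k (softAttn (freq s) u)
      ≤ 2 * (if ∀ i, s i ≠ k then 1 else 0) + 2 * Real.exp (-(p k * N)) := by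
    intro s
    split_ifs with h
    · linarith [sqDist_le_two (hPw.attn u s) k, Real.exp_pos (-(p k * N))]
    · push Not at h
      have h2 := one_div_le_freq h
      have h3 : Real.exp N ≤ freq s k * Real.exp (u k) := by
        have h4 : (N : ℝ) ≤ Real.exp N := by linarith [Real.add_one_le_exp (N : ℝ)]
        calc Real.exp N = 1 / N * (N * Real.exp N) := by field_simp
          _ ≤ 1 / N * (Real.exp N * Real.exp N) := by gcongr
          _ = 1 / N * Real.exp (u k) := by simp [hu, ← Real.exp_add, two_mul]
          _ ≤ _ := mul_le_mul_of_nonneg_right h2 (Real.exp_pos _).le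
      have h5 : 1 - softAttn (freq s) u k ≤ Real.exp (-N) := by
        have hw := hPw.weight s
        rw [one_sub_softAttn hw, partition_eq _ u k, Real.exp_neg, ← one_div]
        have h6 : ∑ m ∈ Finset.univ.erase k, freq s m * Real.exp (u m) ≤ 1 :=
          hw.sum_mul_le _ zero_le_one fun m hm => by
            simp [hu, Finset.ne_of_mem_erase hm]
        exact div_le_div₀ zero_le_one h6 (Real.exp_pos _)
          (by linarith [rest_nonneg hw u k])
      have h6 := (hPw.attn u s).le_one k
      have h7 : (1 - softAttn (freq s) u k) ^ 2 ≤ Real.exp (-(p k * N)) := by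
        have h8 : Real.exp (-N) ≤ 1 := Real.exp_le_one_iff.2 (by linarith)
        have h9 : Real.exp (-N) ≤ Real.exp (-(p k * N)) :=
          Real.exp_le_exp.2 (by nlinarith [hp.le_one k])
        nlinarith [Real.exp_pos (-(N : ℝ))]
      linarith [sqDist_le (hPw.attn u s) k]
  have h2 : ∑ s : Fin N → Fin K, seqProb p s * sqDist k (softAttn (freq s) u)
      ≤ ∑ s : Fin N → Fin K, seqProb p s *
        (2 * (if ∀ i, s i ≠ k then 1 else 0) + 2 * Real.exp (-(p k * N))) :=
    Finset.sum_le_sum fun s _ => mul_le_mul_of_nonneg_left (h1 s) (hPw.prob.nonneg s)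
  have h3 : ∑ s : Fin N → Fin K, seqProb p s *
        (2 * (if ∀ i, s i ≠ k then 1 else 0) + 2 * Real.exp (-(p k * N)))
      = 2 * (1 - p k) ^ N + 2 * Real.exp (-(p k * N)) := by
    rw [← sum_absent hp]
    simp only [mul_add, Finset.sum_add_distrib, ← Finset.sum_mul, hPw.prob.sum_eq_one, one_mul]
    congr 1
    rw [Finset.mul_sum]
    exact Finset.sum_congr rfl fun s _ => by ring
  have h4 : (1 - p k) ^ N ≤ Real.exp (-(p k * N)) := by
    calc (1 - p k) ^ N ≤ Real.exp (-p k) ^ N :=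
          pow_le_pow_left₀ (by linarith [hp.le_one k]) (Real.one_sub_le_exp_neg _) N
      _ = _ := by rw [← Real.exp_nat_mul]; congr 1; ring
  rw [colLoss]
  linarith

variable {μ : MeasureTheory.Measure (Fin d → ℝ)} {v : Fin K → Fin d → ℝ}

lemma le_condLossStar (hN : 0 < N) (hμ : IsTaskDistribution μ) (hv : OrthonormalFeatures v)
    (hp : IsDistribution p) {k : Fin K} (hk : p k ≠ 0) :
    1 / 2 * (1 - p k) ^ N ≤ condLossStar N μ p v k :=
  le_ciInf fun Q => by rw [condLoss_eq hN hμ hv hk]; exact le_colLoss hp k _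

lemma condLossStar_le (hN : 0 < N) (hμ : IsTaskDistribution μ) (hv : OrthonormalFeatures v)
    (hp : IsDistribution p) {k : Fin K} (hk : p k ≠ 0) :
    condLossStar N μ p v k ≤ 2 * Real.exp (-(p k * N)) := by
  have hbdd : BddBelow (Set.range fun Q => condLoss N μ p v k Q) := by
    refine ⟨0, ?_⟩
    rintro _ ⟨Q, rfl⟩
    simp only [condLoss_eq hN hμ hv hk]
    exact colLoss_nonneg (isRandomWeights_freq hp hN) _ _
  refine (ciInf_le hbdd ((2 * (N : ℝ)) • Matrix.vecMulVec (v k) (v k))).trans ?_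
  rw [condLoss_eq hN hμ hv hk]
  refine le_of_eq_of_le ?_ (colLoss_le_two_mul_exp hp hN k)
  congr 1
  funext n
  simp [logit, Matrix.smul_mulVec, Matrix.vecMulVec_mulVec, hv _ _]

end infimum

/-! ### Numbers of iterations -/

lemma log_rpow_neg_half {ε : ℝ} (hε : 0 < ε) :
    Real.log (ε ^ (-(1 / 2) : ℝ)) = Real.log (1 / ε) / 2 := by
  rw [Real.log_rpow hε, one_div ε, Real.log_inv]
  ring

/-- The number of iterations for the dominant feature. -/
lemma exists_colLoss_le_dominant {a ηmax : ℝ} (ha : 0 < a) (ha1 : a ≤ 1) (hηmax : 0 < ηmax) :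
    ∃ C : ℝ, 0 < C ∧ ∀ {ι Ω : Type} [Fintype ι] [DecidableEq ι] [Fintype Ω] {P : Ω → ℝ}
      {w : Ω → ι → ℝ} {G : Finset Ω} {k : ι} {δ η pk ε : ℝ} {u : ℕ → ι → ℝ},
      IsRandomWeights P w → 1 - δ ≤ ∑ s ∈ G, P s → IsDescent P w k (η * pk) u → u 0 = 0 →
      a ≤ pk → pk ≤ 1 → (∀ s ∈ G, a / 2 ≤ w s k) →
      (∀ s ∈ G, ∀ m, m ≠ k → 9 * w s m ≤ a / 2) → 0 < ε → ε < 1 → 0 ≤ δ → δ ≤ a / 4 →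
      2 * δ ≤ ε → C * δ ≤ ε ^ 2 → 0 < η → η ≤ ηmax →
      ∃ T : ℕ, (T : ℝ) ≤ C * (Real.log (ε ^ (-(1 / 2) : ℝ)) / (η * ε)) ∧
        colLoss P w k (u T) ≤ ε := by
  set l₀ : ℝ := Real.log (1 / (1 - a / 2)) / 2 with hl₀
  have hl₀pos : 0 < l₀ := by
    have : 1 < 1 / (1 - a / 2) := by rw [lt_div_iff₀ (by linarith)]; linarith
    have := Real.log_pos this
    positivity
  set θ : ℝ := a / (a + 18) with hθ
  have hθ0 : 0 < θ := by positivity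
  have hlog36 : 0 ≤ Real.log (36 / a) := Real.log_nonneg (by rw [le_div_iff₀ ha]; linarith)
  set C : ℝ := (Real.log (36 / a) / l₀ + 1) / (a * θ) + ηmax / l₀ with hC
  have hC0 : 0 < C := by positivity
  refine ⟨C, hC0, ?_⟩
  intro ι Ω _ _ _ P w G k δ η pk ε u hPw hG hu hu0 hpk hpk1 hwk hwm hε hε1 hδ hδa hδε hCδ hη hηm
  have hl0 : 0 ≤ Real.log (1 / ε) / 2 :=
    div_nonneg (Real.log_nonneg (by rw [le_div_iff₀ hε]; linarith)) zero_le_two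
  rw [log_rpow_neg_half hε]
  set l := Real.log (1 / ε) / 2 with hl
  rcases le_or_gt (1 - a / 2) ε with hbig | hsmall
  · -- for such `ε` the bound on `T` may be less than `1`, and the initial loss is small enough
    refine ⟨0, by simp only [Nat.cast_zero]; positivity, ?_⟩
    have h1 := colLoss_le hPw hG k (u 0) (r := 1 - a / 2) fun s hs => by
      have h2 : softAttn (w s) (u 0) k = w s k := by
        simp [hu0, softAttn, (hPw.weight s).sum_eq_one]
      rw [h2]
      linarith [hwk s hs]
    nlinarith
  · have hll : l₀ ≤ l := by
      rw [hl₀, hl]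
      refine div_le_div_of_nonneg_right (Real.log_le_log ?_ ?_) zero_le_two
      · have : 0 < 1 - a / 2 := by linarith
        positivity
      · exact one_div_le_one_div_of_le hε hsmall.le
    have hpk0 : 0 < pk := by linarith
    have hh : 0 < η * pk := by positivity
    have hx : 0 < η * pk * (θ * ε) := by positivity
    set M : ℕ := ⌈(Real.log (36 / a) + l) / (η * pk * (θ * ε))⌉₊ with hM
    have hMC : (M : ℝ) ≤ C * (l / (η * ε)) := by
      have h1 := (Nat.ceil_lt_add_one
        (by positivity : 0 ≤ (Real.log (36 / a) + l) / (η * pk * (θ * ε)))).le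
      have h2 : (Real.log (36 / a) + l) / (η * pk * (θ * ε))
          ≤ (Real.log (36 / a) / l₀ + 1) * l / (η * a * (θ * ε)) := by
        have h3 : Real.log (36 / a) ≤ Real.log (36 / a) / l₀ * l := by
          rw [div_mul_eq_mul_div, le_div_iff₀ hl₀pos]
          exact mul_le_mul_of_nonneg_left hll hlog36
        refine div_le_div₀ (by positivity) (by linarith) (by positivity) ?_
        gcongr
      have h3 : 1 ≤ ηmax / l₀ * (l / (η * ε)) := by
        rw [div_mul_div_comm, le_div_iff₀ (by positivity)]
        have h4 : η * ε ≤ ηmax := by nlinarith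
        nlinarith [mul_le_mul hll h4 (by positivity) hl0]
      have h4 : (Real.log (36 / a) / l₀ + 1) * l / (η * a * (θ * ε))
          = (Real.log (36 / a) / l₀ + 1) / (a * θ) * (l / (η * ε)) := by
        field_simp
      rw [hC, add_mul, ← h4]
      linarith
    have hlε : l * ε ≤ 1 := by
      have h1 := Real.log_le_sub_one_of_pos (by positivity : 0 < 1 / ε)
      have h2 : 1 / ε * ε = 1 := by field_simp
      rw [hl]
      nlinarith
    obtain ⟨t, ht, htl⟩ := exists_colLoss_le_of_dominance hPw hG hu hh (half_pos ha) hwk (U := 0)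
      (θ := θ) (ε := ε) (t₀ := 0) (M := M)
      (by simpa using hwm) hθ0.le (by rw [hθ, div_le_one (by positivity)]; linarith)
      (by rw [hθ, Real.exp_zero]; exact le_of_eq (by field_simp; ring)) hε hδ hδε
      (by
        calc (M : ℝ) * (η * pk * δ) ≤ C * (l / (η * ε)) * (η * 1 * δ) := by gcongr
          _ = C * δ * (l * ε) / ε ^ 2 := by field_simp
          _ ≤ 1 := by
            rw [div_le_one (by positivity)]
            exact (mul_le_of_le_one_right (by positivity) hlε).trans hCδ)
      (by intro m _; rw [hu0]; exact zero_le_one) (by rw [hu0]; rfl)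
      (by
        have h1 : 18 / (a / 2) = 36 / a := by field_simp; norm_num
        rw [h1, Real.log_mul (by positivity) (Real.rpow_pos_of_pos hε _).ne',
          log_rpow_neg_half hε, zero_add, ← div_le_iff₀ hx]
        exact Nat.le_ceil _)
    refine ⟨t, ?_, htl⟩
    rw [zero_add] at ht
    exact (Nat.cast_le.2 ht).trans hMC

lemma eventually_pow_log_le (m : ℕ) {c : ℝ} (hc : 0 < c) :
    ∀ᶠ K : ℕ in atTop, Real.log K ^ m ≤ c * K := by
  have h := (Real.isLittleO_pow_log_id_atTop (n := m)).bound hc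
  filter_upwards [tendsto_natCast_atTop_atTop.eventually h] with K hK
  refine (le_abs_self _).trans ?_
  simpa using hK

lemma eventually_le_natCast (x : ℝ) : ∀ᶠ K : ℕ in atTop, x ≤ K :=
  tendsto_natCast_atTop_atTop.eventually (eventually_ge_atTop x)

/-- Constants for the forces in the early phase that do not depend on the number of features. -/
lemma exists_earlyForce_constants {α β ρ : ℝ} (hα : 0 < α) (hα1 : α ≤ 1) (hβ : 0 < β)
    (hρ : 0 < ρ) :
    ∃ q B : ℝ, 0 < q ∧ 0 < B ∧ ∀ {ι Ω : Type} [Fintype ι] [DecidableEq ι] [Fintype Ω]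
      {P : Ω → ℝ} {w : Ω → ι → ℝ} {G : Finset Ω} {k D : ι} {u : ι → ℝ} {δ r : ℝ},
      IsRandomWeights P w → 1 - δ ≤ ∑ s ∈ G, P s → D ≠ k → 0 < r → δ ≤ r ^ 2 → δ ≤ 1 / 2 →
      (∀ s ∈ G, α * r ≤ w s k) → (∀ s ∈ G, ∀ m, m ≠ D → w s m ≤ β * r) →
      (∀ s ∈ G, α / 2 ≤ ∑ m ∈ (Finset.univ.erase k).erase D, w s m) →
      (∀ m, m ≠ k → m ≠ D → |u m| ≤ 1) → u D ≤ 1 → 0 ≤ u k → Real.exp (u k) * r ≤ ρ →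
      ∃ Y, EarlyForce q B r k D (u D) (force P w k u) Y := by
  obtain ⟨c, hc⟩ : ∃ c, c = α / (6 * (3 + β * ρ)) := ⟨_, rfl⟩
  obtain ⟨C, hC⟩ : ∃ C, C = (18 * β + 6) / α := ⟨_, rfl⟩
  have hc0 : 0 < c := by rw [hc]; positivity
  have hC0 : 0 < C := by rw [hC]; positivity
  have hc1 : c ≤ 1 := by
    rw [hc, div_le_one (by positivity)]
    nlinarith [mul_pos hβ hρ]
  refine ⟨c ^ 3 / 2, C + C / c ^ 2 + 4 * C ^ 2 / c ^ 3 + 2 / c ^ 3 + C ^ 2 / c ^ 4 + C ^ 2,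
    by positivity, by positivity, ?_⟩
  intro ι Ω _ _ _ P w G k D u δ r hPw hG hD hr hδr hδ hk hw hmass hO hD1 hk0 hkρ
  refine exists_earlyForce hPw hG hD hc0 hc1 hC0 hr hδr hδ fun s hs => ?_
  rw [hc, hC]
  exact isSpread_softAttn (hPw.weight s) hD hα hβ hr hρ (hk s hs) (hw s hs k hD.symm)
      (fun m _ hmD => hw s hs m hmD) (hmass s hs) hO hD1 hk0 hkρ

/-- A number `M` of steps in which the target logit of a rare feature gains `2 * L`, and which is
small enough for the contribution of atypical prompts to be negligible. -/
lemma exists_steps_rare {a b ηmax K L η pk ε : ℝ} (ha : 0 < a) (hb : 0 < b) (hηmax : 0 < ηmax)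
    (hK : 1 ≤ K) (hL : 1 ≤ L) (hη : 0 < η) (hηm : η ≤ ηmax) (hpk : a / K ≤ pk)
    (hpk' : pk ≤ b / K) (hε : 0 < ε) (hε1 : ε < 1) (hLε : L * ε ≤ K) :
    ∃ M : ℕ, (M : ℝ) ≤ (4 / a + ηmax) * (K * L / (ε * η)) ∧
      2 * L ≤ M * (η * pk * (1 / 2 * ε)) ∧
      M * (η * pk) ≤ (4 / a + ηmax) * b * K / ε ^ 2 := by
  have hK0 : 0 < K := by linarith
  have hpk0 : 0 < pk := lt_of_lt_of_le (by positivity) hpk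
  have hha : η * a / K ≤ η * pk := by
    rw [mul_div_assoc]; exact mul_le_mul_of_nonneg_left hpk hη.le
  have hhb : η * pk ≤ η * b / K := by
    rw [mul_div_assoc]; exact mul_le_mul_of_nonneg_left hpk' hη.le
  have hx : 0 < η * pk * (1 / 2 * ε) := by positivity
  have hMC : (⌈2 * L / (η * pk * (1 / 2 * ε))⌉₊ : ℝ) ≤ (4 / a + ηmax) * (K * L / (ε * η)) := by
    have h1 := (Nat.ceil_lt_add_one
      (by positivity : 0 ≤ 2 * L / (η * pk * (1 / 2 * ε)))).le
    have h2 : 2 * L / (η * pk * (1 / 2 * ε)) ≤ 2 * L / (η * a / K * (1 / 2 * ε)) := by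
      gcongr
    have h3 : 2 * L / (η * a / K * (1 / 2 * ε)) = 4 / a * (K * L / (ε * η)) := by
      field_simp; norm_num
    have h4 : 1 ≤ ηmax * (K * L / (ε * η)) := by
      rw [← mul_div_assoc, le_div_iff₀ (by positivity)]
      have h5 : ε * η ≤ ηmax := by nlinarith
      have h6 : 1 ≤ K * L := by nlinarith
      nlinarith
    linarith
  refine ⟨_, hMC, ?_, ?_⟩
  · rw [← div_le_iff₀ hx]
    exact Nat.le_ceil _
  · calc _ ≤ (4 / a + ηmax) * (K * L / (ε * η)) * (η * b / K) :=
          mul_le_mul hMC hhb (by positivity) (by positivity)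
      _ = (4 / a + ηmax) * b * (L * ε) / ε ^ 2 := by field_simp
      _ ≤ _ := by gcongr

/-- The under-represented target `k` reaches the level `log (ρ * K)`, at which it can dominate all
other features, while the other logits stay bounded. -/
lemma exists_early_exit_rare {α β ρ h₀ : ℝ} (hα0 : 0 < α) (hα1 : α ≤ 1) (hβ0 : 0 < β)
    (hρ1 : 1 ≤ ρ) :
    ∃ q : ℝ, 0 < q ∧ ∀ᶠ K : ℕ in atTop, ∀ {Ω : Type} [Fintype Ω] {P : Ω → ℝ}
      {w : Ω → Fin K → ℝ} {G : Finset Ω} {k D : Fin K} {δ h : ℝ} {u : ℕ → Fin K → ℝ},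
      IsRandomWeights P w → 1 - δ ≤ ∑ s ∈ G, P s → IsDescent P w k h u → u 0 = 0 →
      D ≠ k → 0 < h → h ≤ h₀ / K → (∀ s ∈ G, ∀ m, α * (1 / K) ≤ w s m) →
      (∀ s ∈ G, ∀ m, m ≠ D → w s m ≤ β * (1 / K)) → δ ≤ (1 / K) ^ 2 →
      ∃ t : ℕ, (t : ℝ) ≤ Real.log (ρ * K) / (h * (q * (1 / K))) + 1 ∧
        Real.log (ρ * K) ≤ u t k ∧ ∀ m, m ≠ k → u t m ≤ 1 := by
  have hρ0 : 0 < ρ := by linarith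
  obtain ⟨q, B, hq0, hB0, hforce⟩ := exists_earlyForce_constants hα0 hα1 hβ0 hρ0
  refine ⟨q, hq0, ?_⟩
  filter_upwards [eventually_le_natCast 4, eventually_le_natCast ρ,
    eventually_le_natCast (2 * h₀), eventually_le_natCast (2 * (B / q * (q + 10 * B))),
    eventually_pow_log_le 1 (c := 1 / (2 * (B / q * (2 * (q + 10 * B) + 1)))) (by positivity)]
    with K hK4 hKρ hKh hKB hKlog
  intro Ω _ P w G k D δ h u hPw hG hu hu0 hD hh hhK hw hw' hδr
  have hK0 : (0 : ℝ) < K := by linarith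
  set r : ℝ := 1 / K with hr
  have hr0 : 0 < r := by positivity
  have hrK : r * K = 1 := by rw [hr]; field_simp
  have hr1 : r ≤ 1 := by rw [hr, div_le_one hK0]; linarith
  have hlogr : Real.log r = -Real.log K := by rw [hr, one_div, Real.log_inv]
  set U := Real.log (ρ * K) with hU
  have hU0 : 0 ≤ U := Real.log_nonneg (by nlinarith)
  have hU2 : U ≤ 2 * Real.log K := by
    rw [hU, Real.log_mul hρ0.ne' hK0.ne']
    linarith [Real.log_le_log hρ0 hKρ]
  have hexpU : Real.exp U = ρ * K := Real.exp_log (by positivity)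
  have hh1 : h ≤ 1 / 2 := by
    refine hhK.trans ?_
    rw [div_le_iff₀ hK0]
    linarith
  have hcard : α / 2 ≤ ((K : ℝ) - 2) * (α * r) := by
    have h1 : 0 ≤ α * r * (K / 2 - 2) := mul_nonneg (by positivity) (by linarith)
    have h2 : α * (r * K) = α := by rw [hrK, mul_one]
    linarith
  have hδ2 : δ ≤ 1 / 2 := by
    refine hδr.trans ?_
    have : r ≤ 1 / 4 := by rw [hr]; exact one_div_le_one_div_of_le (by norm_num) hK4
    nlinarith
  have hmass : ∀ s ∈ G, α / 2 ≤ ∑ m ∈ (Finset.univ.erase k).erase D, w s m := by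
    intro s hs
    refine hcard.trans ?_
    have h1 := Finset.card_nsmul_le_sum ((Finset.univ.erase k).erase D) (w s) (α * r)
      fun m _ => hw s hs m
    have h2 : ((Finset.univ.erase k).erase D).card = K - 2 := by
      rw [Finset.card_erase_of_mem (Finset.mem_erase.2 ⟨hD, Finset.mem_univ D⟩),
        Finset.card_erase_of_mem (Finset.mem_univ k), Finset.card_univ, Fintype.card_fin]
      omega
    have h3 : 2 ≤ K := by
      have : (2 : ℝ) ≤ K := by linarith
      exact_mod_cast this
    rw [h2, nsmul_eq_mul, Nat.cast_sub h3] at h1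
    exact_mod_cast h1
  exact exists_early_exit (u := u) (F := fun t => force P w k (u t))
    (U := U) (q := q) (B := B) (r := r) hD hu0 hu hq0 hB0 hr0 hr1 hh hh1 hU0
    (fun t => force_self_le_two hPw k (u t)) (fun t n hn => abs_force_le_one hPw hn (u t))
    (by
      intro t hO hD1 hk0 hkU
      refine hforce hPw hG hD hr0 hδr hδ2 (fun s hs => hw s hs k) (fun s hs => hw' s hs) hmass
        hO hD1 hk0 ?_
      calc Real.exp (u t k) * r ≤ Real.exp U * r :=
            mul_le_mul_of_nonneg_right (Real.exp_le_exp.2 hkU) hr0.le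
        _ = ρ := by rw [hexpU, mul_assoc, mul_comm (K : ℝ), hrK, mul_one])
    (by
      rw [hlogr]
      have hy : 0 < B / q := by positivity
      set y := B / q
      have hz : 0 < q + 10 * B := by positivity
      set z := q + 10 * B
      have h1 : y * (2 * z + 1) * Real.log K ≤ 1 / 2 * K := by
        rw [pow_one, div_mul_eq_mul_div, le_div_iff₀ (by positivity)] at hKlog
        linarith
      have h2 : B * r / q = r * y := by ring
      have h3 : y * (z * (U + 1) - -Real.log K) ≤ K := by
        have h4 : z * (U + 1) ≤ z * (2 * Real.log K + 1) :=
          mul_le_mul_of_nonneg_left (by linarith) hz.le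
        have h5 := mul_le_mul_of_nonneg_left h4 hy.le
        linarith
      rw [h2, mul_assoc]
      exact (mul_le_mul_of_nonneg_left h3 hr0.le).trans hrK.le)

/-- The number of iterations for an under-represented feature. -/
lemma exists_colLoss_le_rare {a b ηmax : ℝ} (ha : 0 < a) (ha1 : a ≤ 1) (hb : 0 < b)
    (hηmax : 0 < ηmax) :
    ∃ C : ℝ, 0 < C ∧ ∀ᶠ K : ℕ in atTop, ∀ {Ω : Type} [Fintype Ω] {P : Ω → ℝ}
      {w : Ω → Fin K → ℝ} {G : Finset Ω} {k D : Fin K} {δ η pk ε : ℝ} {u : ℕ → Fin K → ℝ},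
      IsRandomWeights P w → 1 - δ ≤ ∑ s ∈ G, P s → IsDescent P w k (η * pk) u → u 0 = 0 →
      D ≠ k → a / K ≤ pk → pk ≤ b / K → (∀ s ∈ G, ∀ m, a / 2 * (1 / K) ≤ w s m) →
      (∀ s ∈ G, ∀ m, m ≠ D → w s m ≤ 3 * b / 2 * (1 / K)) → 0 < ε → ε < 1 → 0 ≤ δ →
      δ ≤ (1 / K) ^ 2 → 2 * δ ≤ ε → C * K * δ ≤ ε ^ 2 → 0 < η → η ≤ ηmax →
      ∃ T : ℕ, (T : ℝ) ≤ C * (Real.log K * K ^ 2 / η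
          + K * Real.log (K * ε ^ (-(1 / 2) : ℝ)) / (ε * η)) ∧
        colLoss P w k (u T) ≤ ε := by
  set α := a / 2 with hα
  set β := 3 * b / 2 with hβ
  set ρ := 9 / α with hρ
  have hα0 : 0 < α := by positivity
  have hβ0 : 0 < β := by positivity
  have hρ0 : 0 < ρ := by positivity
  have hρ1 : 1 ≤ ρ := by rw [hρ, le_div_iff₀ hα0]; linarith
  obtain ⟨q, hq0, hearly⟩ := exists_early_exit_rare hα0 (by linarith : α ≤ 1) hβ0 hρ1
    (h₀ := ηmax * b)
  set C := max (2 / (a * q) + ηmax) ((4 / a + ηmax) * max b 1) with hC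
  have hC1 : 2 / (a * q) + ηmax ≤ C := le_max_left _ _
  have hC2 : (4 / a + ηmax) * max b 1 ≤ C := le_max_right _ _
  have hC3 : (4 / a + ηmax) ≤ C := le_trans (le_mul_of_one_le_right (by positivity)
    (le_max_right _ _)) hC2
  have hC4 : (4 / a + ηmax) * b ≤ C :=
    le_trans (mul_le_mul_of_nonneg_left (le_max_left _ _) (by positivity)) hC2
  have hC0 : 0 < C := lt_of_lt_of_le (by positivity) hC1
  refine ⟨C, hC0, ?_⟩
  filter_upwards [hearly, eventually_le_natCast 3, eventually_le_natCast ρ,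
    eventually_le_natCast (18 / α)] with K hK hK3 hKρ hKα
  intro Ω _ P w G k D δ η pk ε u hPw hG hu hu0 hD hpk hpk' hw hw' hε hε1 hδ hδr hδε hCδ hη hηm
  have hK0 : (0 : ℝ) < K := by linarith
  set r : ℝ := 1 / K with hr
  have hr0 : 0 < r := by positivity
  have hrK : r * K = 1 := by rw [hr]; field_simp
  have hlogK : 1 ≤ Real.log K := by
    rw [Real.le_log_iff_exp_le hK0]
    linarith [exp_one_lt_three]
  set U := Real.log (ρ * K) with hU
  have hU0 : 0 ≤ U := Real.log_nonneg (by nlinarith)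
  have hU2 : U ≤ 2 * Real.log K := by
    rw [hU, Real.log_mul hρ0.ne' hK0.ne']
    linarith [Real.log_le_log hρ0 hKρ]
  have hexpU : Real.exp U = ρ * K := Real.exp_log (by positivity)
  have hpk0 : 0 < pk := lt_of_lt_of_le (by positivity) hpk
  have hh : 0 < η * pk := by positivity
  have hha : η * a / K ≤ η * pk := by
    rw [mul_div_assoc]; exact mul_le_mul_of_nonneg_left hpk hη.le
  have hhb : η * pk ≤ η * b / K := by
    rw [mul_div_assoc]; exact mul_le_mul_of_nonneg_left hpk' hη.le
  obtain ⟨t₁, ht₁, ht₁k, ht₁m⟩ := hK hPw hG hu hu0 hD hh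
    (hhb.trans (by gcongr)) hw hw' hδr
  have hε' : 0 < ε ^ (-(1 / 2) : ℝ) := Real.rpow_pos_of_pos hε _
  have hε'1 : 1 ≤ ε ^ (-(1 / 2) : ℝ) := Real.one_le_rpow_of_pos_of_le_one_of_nonpos hε hε1.le
    (by norm_num)
  set L := Real.log (K * ε ^ (-(1 / 2) : ℝ)) with hL
  have hLeq : L = Real.log K + Real.log (1 / ε) / 2 := by
    rw [hL, Real.log_mul hK0.ne' hε'.ne', log_rpow_neg_half hε]
  have hL1 : 1 ≤ L := by
    exact hlogK.trans (Real.log_le_log hK0 (le_mul_of_one_le_right hK0.le hε'1))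
  have hLε : L * ε ≤ K := by
    have h1 := Real.log_le_sub_one_of_pos (by positivity : 0 < 1 / ε)
    have h2 := Real.log_le_sub_one_of_pos hK0
    have h3 : 1 / ε * ε = 1 := by field_simp
    have h4 : L ≤ K - 1 + 1 / ε := by
      rw [hLeq]
      have : 0 < 1 / ε := by positivity
      linarith
    have h5 := mul_le_mul_of_nonneg_right h4 hε.le
    have h6 : (K - 1) * ε ≤ (K - 1) * 1 := mul_le_mul_of_nonneg_left hε1.le (by linarith)
    linarith
  obtain ⟨M, hMC, hML, hMK⟩ := exists_steps_rare ha hb hηmax (by linarith) hL1 hη hηm hpk hpk' hε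
    hε1 hLε
  obtain ⟨t, ht, htl⟩ := exists_colLoss_le_of_dominance hPw hG hu hh
    (by positivity : 0 < α * r) (fun s hs => hw s hs k) (U := U)
    (θ := 1 / 2) (ε := ε) (t₀ := t₁) (M := M)
    (by
      intro s _ m _
      have h1 : α * r * Real.exp U = 9 * (r * K) := by rw [hexpU, hρ]; field_simp
      rw [h1, hrK]
      linarith [(hPw.weight s).le_one m])
    (by norm_num) (by norm_num)
    (by
      have h1 : α * r * Real.exp U = 9 * (r * K) := by rw [hexpU, hρ]; field_simp
      rw [h1, hrK]
      norm_num) hε hδ hδε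
    (by
      calc (M : ℝ) * (η * pk * δ) = M * (η * pk) * δ := by ring
        _ ≤ (4 / a + ηmax) * b * K / ε ^ 2 * δ := mul_le_mul_of_nonneg_right hMK hδ
        _ ≤ C * K / ε ^ 2 * δ := by gcongr
        _ = C * K * δ / ε ^ 2 := by ring
        _ ≤ 1 := (div_le_one (by positivity)).2 hCδ)
    ht₁m ht₁k
    (by
      have h1 : 18 / (α * r) * ε ^ (-(1 / 2) : ℝ) = 18 / α * (K * ε ^ (-(1 / 2) : ℝ)) := by
        rw [hr]; field_simp
      have h2 : Real.log (18 / α) ≤ L :=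
        Real.log_le_log (by positivity) (hKα.trans (le_mul_of_one_le_right hK0.le hε'1))
      rw [h1, Real.log_mul (by positivity) (by positivity)]
      linarith)
  refine ⟨t, ?_, htl⟩
  have h1 : (t : ℝ) ≤ t₁ + M := by exact_mod_cast ht
  have h2 : U / (η * pk * (q * r)) + 1 ≤ (2 / (a * q) + ηmax) * (Real.log K * K ^ 2 / η) := by
    have h3 : U / (η * pk * (q * r)) ≤ 2 * Real.log K / (η * a / K * (q * r)) := by
      gcongr
    have h4 : 2 * Real.log K / (η * a / K * (q * r))
        = 2 / (a * q) * (Real.log K * K ^ 2 / η) := by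
      rw [hr]; field_simp
    have h5 : 1 ≤ ηmax * (Real.log K * K ^ 2 / η) := by
      rw [← mul_div_assoc, le_div_iff₀ hη]
      have h6 : 1 ≤ Real.log K * (K : ℝ) ^ 2 :=
        one_le_mul_of_one_le_of_one_le hlogK (one_le_pow₀ (by linarith))
      rw [one_mul]
      exact hηm.trans (le_mul_of_one_le_right hηmax.le h6)
    linarith
  have h3 := mul_le_mul_of_nonneg_right hC1 (by positivity : 0 ≤ Real.log K * (K : ℝ) ^ 2 / η)
  have h4 := mul_le_mul_of_nonneg_right hC3 (by positivity : 0 ≤ K * L / (ε * η))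
  linarith

/-! ### The model with one dominant feature -/

/-- The tail of the exponential beats the smallest admissible precision. -/
lemma eventually_mul_exp_neg_le (m : ℕ) {c C : ℝ} (hc : 0 < c) (hC : 0 < C) :
    ∀ᶠ K : ℕ in atTop, C * K * Real.exp (-(c * K)) ≤ Real.exp (-(2 * Real.log K ^ m)) := by
  filter_upwards [eventually_pow_log_le m (by positivity : 0 < c / 8),
    eventually_pow_log_le 1 (by positivity : 0 < c / 4),
    eventually_le_natCast (4 / c * Real.log C), eventually_le_natCast 1] with K h1 h2 h3 h4
  have hK : (0 : ℝ) < K := by linarith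
  rw [← Real.exp_log (by positivity : 0 < C * K), ← Real.exp_add, Real.exp_le_exp,
    Real.log_mul hC.ne' hK.ne']
  rw [div_mul_eq_mul_div, div_le_iff₀ hc] at h3
  rw [pow_one] at h2
  linarith [mul_pos hc hK]

/-- One dominant feature `D` and features of probability of order `1 / K`. -/
structure IsImbalanced {K : ℕ} (a b : ℝ) (p : Fin K → ℝ) (D : Fin K) : Prop where
  sum_eq_one : ∑ k, p k = 1
  le_dominant : a ≤ p D
  rare : ∀ k, k ≠ D → a / K ≤ p k ∧ p k ≤ b / K

namespace IsImbalanced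

variable {K : ℕ} {a b : ℝ} {p : Fin K → ℝ} {D : Fin K} (h : IsImbalanced a b p D)
include h

lemma div_le (ha : 0 < a) (hK : 1 ≤ (K : ℝ)) (k : Fin K) : a / K ≤ p k := by
  by_cases hk : k = D
  · rw [hk]
    exact (div_le_self ha.le hK).trans h.le_dominant
  · exact (h.rare k hk).1

lemma pos (ha : 0 < a) (hK : 1 ≤ (K : ℝ)) (k : Fin K) : 0 < p k :=
  lt_of_lt_of_le (div_pos ha (by linarith)) (h.div_le ha hK k)

lemma isDistribution (ha : 0 < a) (hK : 1 ≤ (K : ℝ)) : IsDistribution p :=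
  ⟨fun k => (h.pos ha hK k).le, h.sum_eq_one⟩

lemma half_le_one_sub (ha : 0 < a) (hK : 2 ≤ (K : ℝ)) : a / 2 ≤ 1 - p D := by
  have hp := h.isDistribution ha (by linarith)
  have h1 := Finset.card_nsmul_le_sum (Finset.univ.erase D) p (a / K)
    fun m _ => h.div_le ha (by linarith) m
  have hK2 : 1 ≤ K := by
    have : (1 : ℝ) ≤ K := by linarith
    exact_mod_cast this
  rw [hp.sum_erase, Finset.card_erase_of_mem (Finset.mem_univ D), Finset.card_univ,
    Fintype.card_fin, nsmul_eq_mul, Nat.cast_sub hK2] at h1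
  refine le_trans ?_ h1
  rw [← mul_div_assoc, le_div_iff₀ (by linarith)]
  push_cast
  nlinarith

variable {N : ℕ}

lemma freq_bounds (ha : 0 < a) (hK : 1 ≤ (K : ℝ)) {s : Fin N → Fin K}
    (hs : s ∈ typical p N (a / (2 * K))) (n : Fin K) :
    p n / 2 ≤ freq s n ∧ freq s n ≤ 3 * p n / 2 := by
  have h1 := abs_le.1 ((Finset.mem_filter.1 hs).2 n)
  have h2 := h.div_le ha hK n
  have h3 : a / (2 * K) = a / K / 2 := by field_simp
  rw [h3] at h1
  constructor <;> linarith

end IsImbalanced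

section consequences

variable {d K N : ℕ} {μ : MeasureTheory.Measure (Fin d → ℝ)} {v : Fin K → Fin d → ℝ}
  {p : Fin K → ℝ}

lemma isDescent_logit_gd (hN : 0 < N) (hμ : IsTaskDistribution μ) (hv : OrthonormalFeatures v)
    (η : ℝ) (k : Fin K) :
    IsDescent (seqProb p) (freq (N := N)) k (η * p k)
      fun t => logit v (gd N μ p v η t) k :=
  fun t n => logit_gd_succ hN hμ hv p η t k n

lemma sum_le_inputProb (hp : IsDistribution p) (G : Finset (Fin N → Fin K))
    {S : Set (Fin N → Fin K)} (h : ∀ s ∈ G, s ∈ S) : ∑ s ∈ G, seqProb p s ≤ inputProb p S := by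
  have hnn := (isDistribution_seqProb hp (N := N)).nonneg
  calc ∑ s ∈ G, seqProb p s = ∑ s ∈ G, S.indicator (seqProb p) s :=
        Finset.sum_congr rfl fun s hs => (Set.indicator_of_mem (h s hs) _).symm
    _ ≤ _ := Finset.sum_le_sum_of_subset_of_nonneg (Finset.subset_univ _) fun s _ _ =>
        Set.indicator_nonneg (fun s _ => hnn s) s

/-- A parameter with loss at most `ε` is `ε`-optimal, and its attention deficits are small on all
typical prompts. -/
lemma condLoss_le_and_le_inputProb {a b c δ ε C : ℝ} {D k : Fin K} {Q : Matrix (Fin d) (Fin d) ℝ}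
    (hN : 0 < N) (hμ : IsTaskDistribution μ) (hv : OrthonormalFeatures v)
    (h : IsImbalanced a b p D) (ha : 0 < a) (hK : 1 ≤ (K : ℝ)) (hε : 0 < ε)
    (hG : 1 - Real.exp (-(c * (N / K ^ 2))) ≤ ∑ s ∈ typical p N (a / (2 * K)), seqProb p s)
    (hGδ : 1 - δ ≤ ∑ s ∈ typical p N (a / (2 * K)), seqProb p s) (hδ : δ ≤ 1 / 2)
    (hC : 324 ≤ C) (hQ : colLoss (seqProb p) (freq (N := N)) k (logit v Q k) ≤ ε) :
    condLoss N μ p v k Q ≤ condLossStar N μ p v k + ε ∧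
      1 - Real.exp (-(c * (N / K ^ 2))) ≤
        inputProb p {s : Fin N → Fin K | (1 - featureAttn v Q s k k) ^ 2 ≤ C * ε} := by
  have hp := h.isDistribution ha hK
  have hk := (h.pos ha hK k).ne'
  constructor
  · rw [condLoss_eq hN hμ hv hk]
    have h1 := le_condLossStar hN hμ hv hp hk
    have h2 : 0 ≤ (1 - p k) ^ N := pow_nonneg (by linarith [hp.le_one k]) N
    linarith
  · refine hG.trans (sum_le_inputProb hp _ fun s hs => ?_)
    simp only [Set.mem_ofPred_eq, featureAttn_eq hN]
    have h1 := sq_one_sub_softAttn_le (isRandomWeights_freq hp hN) hGδ hδ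
      (fun s hs s' hs' n => by
        linarith [(h.freq_bounds ha hK hs n).2, (h.freq_bounds ha hK hs' n).1]) k (logit v Q k) hs
    nlinarith

end consequences

lemma exp_neg_le_half_mul_pow {a : ℝ} {x : ℝ} {N : ℕ} (ha : 0 < a) (hN : 0 < N)
    (hx : a / 2 ≤ x) : Real.exp (-(Real.log (4 / a) * N)) ≤ 1 / 2 * x ^ N := by
  have h1 : Real.exp (-(Real.log (4 / a) * N)) = (1 / 2 * (a / 2)) ^ N := by
    rw [← neg_mul, ← Real.log_inv, mul_comm, Real.exp_nat_mul, Real.exp_log (by positivity)]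
    congr 1
    field_simp
    norm_num
  rw [h1, mul_pow]
  refine mul_le_mul (pow_le_of_le_one (by norm_num) (by norm_num) hN.ne')
    (pow_le_pow_left₀ (by positivity) hx N) (by positivity) (by norm_num)

lemma exp_neg_two_mul_le {x : ℝ} (hx : 0 ≤ x) (hx1 : x ≤ 1 / 2) :
    Real.exp (-(2 * x)) ≤ 1 - x := by
  rw [Real.exp_neg, inv_le_comm₀ (Real.exp_pos _) (by linarith)]
  refine le_trans ?_ (Real.add_one_le_exp (2 * x))
  rw [inv_le_iff_one_le_mul₀ (by linarith)]
  nlinarith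

lemma exp_neg_le_half_mul_pow_div {b x y : ℝ} {N : ℕ} (hb : 0 < b) (hy : 2 * b ≤ y)
    (hyN : y ≤ N) (hx : x ≤ b / y) :
    Real.exp (-((2 * b + 1) * (N / y))) ≤ 1 / 2 * (1 - x) ^ N := by
  have hy0 : 0 < y := by linarith
  have h1 : Real.exp (-(2 * (b / y))) ≤ 1 - x :=
    (exp_neg_two_mul_le (by positivity) (by rw [div_le_iff₀ hy0]; linarith)).trans (by linarith)
  have h2 : Real.exp (-(N / y)) ≤ 1 / 2 := by
    have h3 : 1 ≤ N / y := by rw [le_div_iff₀ hy0]; linarith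
    have h4 : (2 : ℝ) ≤ Real.exp (N / y) := by linarith [Real.add_one_le_exp ((N : ℝ) / y)]
    rw [Real.exp_neg, one_div]
    exact inv_anti₀ two_pos h4
  calc Real.exp (-((2 * b + 1) * (N / y)))
      = Real.exp (-(N / y)) * Real.exp (-(2 * (b / y))) ^ N := by
        rw [← Real.exp_nat_mul, ← Real.exp_add]; congr 1; ring
    _ ≤ _ := mul_le_mul h2 (pow_le_pow_left₀ (Real.exp_pos _).le h1 N) (by positivity)
        (by norm_num)

lemma two_mul_exp_neg_le {x y : ℝ} (h : 1 ≤ x - y) :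
    2 * Real.exp (-x) ≤ Real.exp (-y) := by
  have h1 : (2 : ℝ) ≤ Real.exp (x - y) := by linarith [Real.add_one_le_exp (x - y)]
  calc 2 * Real.exp (-x) ≤ Real.exp (x - y) * Real.exp (-x) :=
        mul_le_mul_of_nonneg_right h1 (Real.exp_pos _).le
    _ = Real.exp (-y) := by rw [← Real.exp_add]; congr 1; ring

end ICL

end

theorem theorem2 (a b ηmax : ℝ) (ha : 0 < a) (hb : 0 < b) (hηmax : 0 < ηmax) :
    ∃ c C : ℝ, 0 < c ∧ 0 < C ∧ ∀ m : ℕ, ∃ K₀ : ℕ, ∀ K N d : ℕ, K₀ ≤ K → K ^ 3 ≤ N →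
      ∀ (v : Fin K → Fin d → ℝ) (p : Fin K → ℝ) (dom : Fin K)
        (μ : MeasureTheory.Measure (Fin d → ℝ)) (ε η : ℝ),
        ICL.OrthonormalFeatures v → ICL.IsTaskDistribution μ →
        ∑ k, p k = 1 → a ≤ p dom → (∀ k, k ≠ dom → a / K ≤ p k ∧ p k ≤ b / K) →
        0 < ε → ε < 1 → Real.log (1 / ε) ≤ Real.log K ^ m →
        0 < η → η ≤ ηmax →
        -- the dominant feature
        (Real.exp (-(C * N)) ≤ ICL.condLossStar N μ p v dom ∧
          ICL.condLossStar N μ p v dom ≤ Real.exp (-(c * N)) ∧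
          ∃ T : ℕ,
            (T : ℝ) ≤ C * (Real.log (ε ^ (-(1 / 2) : ℝ)) / (η * ε)) ∧
            ICL.condLoss N μ p v dom (ICL.gd N μ p v η T)
              ≤ ICL.condLossStar N μ p v dom + ε ∧
            1 - Real.exp (-(c * (N / K ^ 2))) ≤
              ICL.inputProb p {s : Fin N → Fin K |
                (1 - ICL.featureAttn v (ICL.gd N μ p v η T) s dom dom) ^ 2 ≤ C * ε}) ∧
        -- the under-represented features
        (∀ k, k ≠ dom →
          Real.exp (-(C * (N / K))) ≤ ICL.condLossStar N μ p v k ∧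
          ICL.condLossStar N μ p v k ≤ Real.exp (-(c * (N / K))) ∧
          ∃ T : ℕ,
            (T : ℝ) ≤ C * (Real.log K * K ^ 2 / η
              + K * Real.log (K * ε ^ (-(1 / 2) : ℝ)) / (ε * η)) ∧
            ICL.condLoss N μ p v k (ICL.gd N μ p v η T)
              ≤ ICL.condLossStar N μ p v k + ε ∧
            1 - Real.exp (-(c * (N / K ^ 2))) ≤
              ICL.inputProb p {s : Fin N → Fin K |
                (1 - ICL.featureAttn v (ICL.gd N μ p v η T) s k k) ^ 2 ≤ C * ε}) := by
  rcases lt_or_ge 1 a with ha1 | ha1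
  · -- a probability is not larger than `1`, so there is no admissible `p`
    refine ⟨1, 1, one_pos, one_pos, fun m => ⟨1, ?_⟩⟩
    intro K N d hK _ v p dom μ ε η _ _ hp hpa hpr
    have h : ICL.IsImbalanced a b p dom := ⟨hp, hpa, hpr⟩
    have := (h.isDistribution ha (by exact_mod_cast hK)).le_one dom
    linarith
  obtain ⟨C₁, hC₁, hdom⟩ := ICL.exists_colLoss_le_dominant ha ha1 hηmax
  obtain ⟨C₂, hC₂, hrare⟩ := ICL.exists_colLoss_le_rare ha ha1 hb hηmax
  have hl : 0 ≤ Real.log (4 / a) := Real.log_nonneg (by rw [le_div_iff₀ ha]; linarith)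
  have hc : 0 < a ^ 2 / 32 := by positivity
  set c := a ^ 2 / 32 with hcdef
  have hca : c ≤ a / 2 := by nlinarith
  set C := Real.log (4 / a) + (2 * b + 1) + C₁ + C₂ + 324 with hCdef
  have hC : 0 < C := by positivity
  refine ⟨c, C, hc, hC, fun m => ?_⟩
  obtain ⟨K₀, hK₀⟩ := Filter.eventually_atTop.1 (hrare.and
    ((ICL.eventually_mul_exp_neg_le m hc hC).and
    ((ICL.eventually_mul_exp_neg_le 1 hc one_pos).and
    ((ICL.eventually_mul_exp_neg_le 0 hc (by positivity : 0 < 4 / a)).and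
    ((ICL.eventually_le_natCast (27 * b / a)).and ((ICL.eventually_le_natCast (2 / a)).and
    ((ICL.eventually_le_natCast (2 * b)).and (ICL.eventually_le_natCast 2))))))))
  refine ⟨K₀, ?_⟩
  intro K N d hK hKN v p dom μ ε η hv hμ hp hpa hpr hε hε1 hεm hη hηm
  obtain ⟨hrK, htail, htail1, htail0, hKb, hKa, hKb2, hK2⟩ := hK₀ K hK
  have h : ICL.IsImbalanced a b p dom := ⟨hp, hpa, hpr⟩
  have hK1 : (1 : ℝ) ≤ K := by linarith
  have hK0 : (0 : ℝ) < K := by linarith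
  have hNK : (K : ℝ) ^ 3 ≤ N := by exact_mod_cast hKN
  have hN0 : 0 < N := by
    have : (0 : ℝ) < N := lt_of_lt_of_le (by positivity) hNK
    exact_mod_cast this
  have hNK2 : (K : ℝ) ≤ N / K ^ 2 := by
    rw [le_div_iff₀ (by positivity)]; linarith
  have hNK1 : (K : ℝ) ≤ N / K := by
    rw [le_div_iff₀ hK0]
    nlinarith
  have hNK' : (K : ℝ) ≤ N := hNK1.trans (div_le_self (Nat.cast_nonneg N) hK1)
  have hpd := h.isDistribution ha hK1
  have hPw := ICL.isRandomWeights_freq hpd hN0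
  -- the probability of atypical prompts
  set δ := Real.exp (-(c * K)) with hδdef
  have hδ0 : 0 < δ := Real.exp_pos _
  have hδa : 4 / a * K * δ ≤ 1 := htail0.trans (Real.exp_le_one_iff.2 (by simp))
  have hKδ : 4 * (K * δ) ≤ a := by
    have : 4 / a * K * δ = 4 * (K * δ) / a := by ring
    rw [this, div_le_one ha] at hδa
    exact hδa
  have hδK : δ ≤ K * δ := le_mul_of_one_le_left hδ0.le hK1
  have hδr : δ ≤ (1 / (K : ℝ)) ^ 2 := by
    have h1 : Real.exp (-(2 * Real.log K ^ 1)) = (1 / (K : ℝ)) ^ 2 := by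
      rw [pow_one, one_div, ← Real.exp_log (inv_pos.2 hK0), Real.log_inv, ← Real.exp_nat_mul]
      congr 1
      push_cast
      ring
    rw [← h1]
    linarith
  have hδε : C * K * δ ≤ ε ^ 2 := by
    refine htail.trans ?_
    rw [← Real.exp_log (by positivity : 0 < ε ^ 2), Real.exp_le_exp, Real.log_pow]
    rw [one_div, Real.log_inv] at hεm
    push_cast
    linarith
  have hεε : ε ^ 2 ≤ ε := by nlinarith
  have hKδ0 : 0 ≤ K * δ := by positivity
  have hpart : ∀ x, 0 ≤ x → x ≤ C → x * (K * δ) ≤ ε ^ 2 := fun x _ hxC =>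
    (mul_le_mul_of_nonneg_right hxC hKδ0).trans (by linarith)
  have hδ2ε : 2 * δ ≤ ε := by
    have := hpart 2 (by norm_num) (by rw [hCdef]; linarith)
    linarith
  have hG : 1 - Real.exp (-(c * (N / K ^ 2)))
      ≤ ∑ s ∈ ICL.typical p N (a / (2 * K)), ICL.seqProb p s := by
    refine le_trans ?_ (ICL.le_sum_typical hpd hN0 (by positivity)
      (by rw [div_le_one (by positivity)]; linarith))
    have h1 : Real.exp (-(N * (a / (2 * K)) ^ 2 / 4))
        = Real.exp (-(c * (N / K ^ 2))) * Real.exp (-(c * (N / K ^ 2))) := by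
      rw [← Real.exp_add, hcdef]
      congr 1
      field_simp
      ring
    have h2 : Real.exp (-(c * (N / K ^ 2))) ≤ δ :=
      Real.exp_le_exp.2 (neg_le_neg (mul_le_mul_of_nonneg_left hNK2 hc.le))
    have h3 : 2 * K * Real.exp (-(c * (N / K ^ 2))) ≤ 1 := by
      have := mul_le_mul_of_nonneg_left h2 (by positivity : 0 ≤ 2 * (K : ℝ))
      linarith
    have h4 := mul_le_mul_of_nonneg_right h3 (Real.exp_pos (-(c * (N / K ^ 2)))).le
    rw [h1]
    linarith
  have hGδ : 1 - δ ≤ ∑ s ∈ ICL.typical p N (a / (2 * K)), ICL.seqProb p s := by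
    refine le_trans ?_ hG
    have : Real.exp (-(c * (N / K ^ 2))) ≤ δ :=
      Real.exp_le_exp.2 (neg_le_neg (mul_le_mul_of_nonneg_left hNK2 hc.le))
    linarith
  have hfin : ∀ k T, ICL.colLoss (ICL.seqProb p) (ICL.freq (N := N)) k
      (ICL.logit v (ICL.gd N μ p v η T) k) ≤ ε → _ := fun k T hT =>
    ICL.condLoss_le_and_le_inputProb hN0 hμ hv h ha hK1 hε hG hGδ (by linarith)
      (by rw [hCdef]; linarith : 324 ≤ C) hT
  have hw : ∀ s ∈ ICL.typical p N (a / (2 * K)), ∀ n, a / 2 * (1 / K) ≤ ICL.freq s n := by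
    intro s hs n
    have h1 := (h.freq_bounds ha hK1 hs n).1
    have h2 := h.div_le ha hK1 n
    have h3 : a / 2 * (1 / K) = a / K / 2 := by ring
    linarith
  have hw' : ∀ s ∈ ICL.typical p N (a / (2 * K)), ∀ n, n ≠ dom →
      ICL.freq s n ≤ 3 * b / 2 * (1 / K) := by
    intro s hs n hn
    have h1 := (h.freq_bounds ha hK1 hs n).2
    have h2 := (hpr n hn).2
    have h3 : 3 * b / 2 * (1 / K) = 3 * (b / K) / 2 := by ring
    linarith
  have hlε : 0 ≤ Real.log (1 / ε) := Real.log_nonneg (by rw [le_div_iff₀ hε]; linarith)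
  have hgap : ∀ y : ℝ, K ≤ y → c * y + 1 ≤ a * y := by
    intro y hy
    rw [div_le_iff₀ ha] at hKa
    have h1 : c * y ≤ a / 2 * y := mul_le_mul_of_nonneg_right hca (by linarith)
    have h2 := mul_le_mul_of_nonneg_right hy ha.le
    linarith
  constructor
  · refine ⟨?_, ?_, ?_⟩
    · refine le_trans ?_ (ICL.le_condLossStar hN0 hμ hv hpd (h.pos ha hK1 dom).ne')
      refine le_trans ?_ (ICL.exp_neg_le_half_mul_pow ha hN0 (h.half_le_one_sub ha hK2))
      refine Real.exp_le_exp.2 (neg_le_neg (mul_le_mul_of_nonneg_right ?_ (Nat.cast_nonneg N)))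
      rw [hCdef]
      linarith
    · refine (ICL.condLossStar_le hN0 hμ hv hpd (h.pos ha hK1 dom).ne').trans
        (ICL.two_mul_exp_neg_le ?_)
      have h1 := mul_le_mul_of_nonneg_right hpa (Nat.cast_nonneg N : (0 : ℝ) ≤ N)
      linarith [hgap N hNK']
    · obtain ⟨T, hT, hTl⟩ := hdom hPw hGδ (ICL.isDescent_logit_gd hN0 hμ hv η dom)
        (ICL.logit_gd_zero v p η dom) hpa (hpd.le_one dom)
        (fun s hs => by linarith [(h.freq_bounds ha hK1 hs dom).1])
        (fun s hs n hn => by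
          have h1 := hw' s hs n hn
          have h2 : 9 * (3 * b / 2 * (1 / K)) ≤ a / 2 := by
            rw [div_le_iff₀ ha] at hKb
            have : 9 * (3 * b / 2 * (1 / K)) = 27 * b / 2 / K := by ring
            rw [this, div_le_iff₀ hK0]
            linarith
          linarith) hε hε1 hδ0.le (by linarith) hδ2ε
        (by
          refine le_trans ?_ (hpart C₁ hC₁.le (by rw [hCdef]; linarith))
          exact mul_le_mul_of_nonneg_left hδK hC₁.le) hη hηm
      refine ⟨T, hT.trans (mul_le_mul_of_nonneg_right (by rw [hCdef]; linarith) ?_),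
        hfin dom T hTl⟩
      rw [ICL.log_rpow_neg_half hε]
      positivity
  · intro k hk
    refine ⟨?_, ?_, ?_⟩
    · refine le_trans ?_ (ICL.le_condLossStar hN0 hμ hv hpd (h.pos ha hK1 k).ne')
      refine le_trans ?_ (ICL.exp_neg_le_half_mul_pow_div hb hKb2 hNK' (hpr k hk).2)
      refine Real.exp_le_exp.2 (neg_le_neg (mul_le_mul_of_nonneg_right ?_ (by positivity)))
      rw [hCdef]
      linarith
    · refine (ICL.condLossStar_le hN0 hμ hv hpd (h.pos ha hK1 k).ne').trans
        (ICL.two_mul_exp_neg_le ?_)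
      have h1 : a * (N / K) ≤ p k * N := by
        have := mul_le_mul_of_nonneg_right (hpr k hk).1 (Nat.cast_nonneg N : (0 : ℝ) ≤ N)
        calc a * (N / K) = a / K * N := by ring
          _ ≤ _ := this
      linarith [hgap (N / K) hNK1]
    · obtain ⟨T, hT, hTl⟩ := hrK hPw hGδ (ICL.isDescent_logit_gd hN0 hμ hv η k)
        (ICL.logit_gd_zero v p η k) hk.symm (hpr k hk).1 (hpr k hk).2 hw hw' hε hε1 hδ0.le hδr
        hδ2ε
        (by
          have := hpart C₂ hC₂.le (by rw [hCdef]; linarith)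
          linarith) hη hηm
      refine ⟨T, hT.trans (mul_le_mul_of_nonneg_right (by rw [hCdef]; linarith) ?_),
        hfin k T hTl⟩
      have h1 : 0 ≤ Real.log K := Real.log_nonneg hK1
      have h2 : 0 ≤ Real.log (K * ε ^ (-(1 / 2) : ℝ)) := by
        rw [Real.log_mul hK0.ne' (Real.rpow_pos_of_pos hε _).ne', ICL.log_rpow_neg_half hε]
        positivity
      positivity
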